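/- Let $X$ be a smooth closed (compact, without boundary) manifold of odd dimension $d$. A generic cellulation $\mathcal C$ of $X$ is a finite division of $X$ into cells such that: each closed $k$-cell is an embedded closed $k$-ball whose boundary sphere is the union of its proper faces; $X$ is the disjoint union of the open cells; the cells are PL cells (the barycentric subdivision of the boundary of a $k$-cell is a PL $(k-1)$-sphere); and locally the cells fit together as the dual cells of a triangulation, i.e. for each $k$-cell $b$ the poset of the cells containing $b$ is anti-isomorphic to the poset of nonempty faces of a simplex with $d+1-k$ vertices, a face with $j$ vertices corresponding to a $(d+1-j)$-cell. The Hilbert space $\mathcal H$ has one qubit for each $(d-1)$-cell; its product basis consists of the configurations $E$, the sets of $(d-1)$-cells that are "present". For a set $E$ of $(d-1)$-cells, $\chi(E)$ is the Euler characteristic (alternating number of cells) of the union of the closed cells in $E$. With Pauli operators $X_f,Z_f$ on the cell $f$, put $$H_+=\sum_{e\ (d-2)\text{-cell}}\frac{1-\prod_{f:\,e\subset\partial f}Z_f}{2},\qquad H_\square^{GTC}=\sum_{c\ d\text{-cell}}\frac{1-\prod_{f\subset\partial c}X_f}{2},\qquad H_\square^{GDS}=\sum_{c\ d\text{-cell}}\frac{1-O_c}{2},$$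 where $O_c=\pm\prod_{f\subset\partial c}X_f$ acts on a configuration $E$ with the sign $-(-1)^{\chi(\uparrow_c)}$, $\uparrow_c$ being the set of the $(d-1)$-cells of $\partial c$ in $E$. The generalized double semion (GDS) and the generalized toric code (GTC) Hamiltonians are $H_++H_\square^{GDS}$ and $H_++H_\square^{GTC}$; the ground space of a Hamiltonian is the eigenspace of its lowest eigenvalue. Let $U$ be the diagonal unitary on $\mathcal H$ that multiplies each configuration $E$ by $i^{\chi(E)}$. Then: 1. $U$ is a local quantum circuit of bounded depth, with bounds depending only on local geometry. For all $d$ odd and $K$ there are numbers $N$ and $s$, and for each $D$ a number $R$, such that the following holds for every closed smooth $d$-manifold $X$, with any metric that induces its topology, and every generic cellulation of $X$ in which each $j$-cell lies in the boundary of at most $K$ $(j+1)$-cells, each $(j+1)$-cell has at most $K$ $j$-cells in its boundary, and each cell has diameter at most $D$: $U$ is a product of at most $N$ rounds, each of them a product of unitary gates with pairwise disjoint supports, where each gate acts on at most $s$ qubits, whose cells have a union of diameter at most $R$. 2. For every generic cellulation of $X$, the lowest eigenvalue of the GDS and of the GTC Hamiltonian is $0$, and $U$ maps the GDS ground space onto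 the GTC ground space. 3. The lowest eigenvalue of $H_+$ is $0$; its ground space is preserved by $U$, $H_\square^{GDS}$ and $H_\square^{GTC}$; and on it $U H_\square^{GDS}U^{-1}=H_\square^{GTC}$. -/

import Mathlib

open scoped Manifold ContDiff

universe u

namespace GDS

/-! ### Combinatorial spheres -/

/-- `K'` is the stellar subdivision of `K` at a face `s`, with new vertex `a`: the open star of `s`
is replaced by the join of `a`, the boundary of `s` and the link of `s`. (When `s` is a single
vertex this just renames that vertex, so stellar equivalence includes isomorphism.) -/
def StellarMove (K K' : PreAbstractSimplicialComplex ℕ) : Prop :=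
  ∃ s ∈ K.faces, ∃ a : ℕ, (∀ t ∈ K.faces, a ∉ t) ∧
    K'.faces = {t | t ∈ K.faces ∧ ¬ s ⊆ t} ∪
      {u | ∃ t : Finset ℕ, t ∪ s ∈ K.faces ∧ ¬ s ⊆ t ∧ u = insert a t}

/-- The boundary of the `k`-simplex with vertices `0, …, k`. -/
def simplexBoundary (k : ℕ) : PreAbstractSimplicialComplex ℕ where
  faces := {s | s.Nonempty ∧ s ⊂ Finset.range (k + 1)}
  isRelLowerSet_faces := fun _ h => ⟨h.1, fun _ hts hne => ⟨hne, lt_of_le_of_lt hts h.2⟩⟩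

/-- `K` is a combinatorial (PL) sphere of dimension `k - 1`: it is PL homeomorphic, that is,
stellar equivalent, to the boundary of the `k`-simplex. (For `k = 0` this is the empty complex.) -/
def IsPLSphere (k : ℕ) (K : PreAbstractSimplicialComplex ℕ) : Prop :=
  Relation.EqvGen StellarMove (simplexBoundary k) K

/-- The order complex (barycentric subdivision) of the subset `S` of the poset `P`, with its
vertices labelled by natural numbers through `label`. -/
def IsOrderComplex {P : Type*} [PartialOrder P] (S : Set P) (label : P ↪ ℕ)
    (K : PreAbstractSimplicialComplex ℕ) : Prop :=
  K.faces = {s | ∃ t : Finset P, t.Nonempty ∧ (t : Set P) ⊆ S ∧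
    IsChain (· ≤ ·) (t : Set P) ∧ s = t.map label}

/-! ### Generic cellulations -/

/-- A generic cellulation of a space `X` (a closed manifold of dimension `d`): a finite division
of `X` into cells. A cell is represented by its closure, a subset of `X`, and the cells are ordered
by inclusion, so `b ≤ c` says that `b` is a face of `c`. -/
structure GenericCellulation (d : ℕ) (X : Type*) [TopologicalSpace X] where
  /-- the closed cells -/
  cells : Set (Set X)
  finite_cells : cells.Finite
  /-- the dimension of a cell -/
  dim : cells → ℕ
  /-- A closed `k`-cell is an embedded closed `k`-ball (an injective continuous map of the compact
  ball into a Hausdorff space is an embedding), and its boundary sphere is the union of its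
  proper faces. -/
  exists_charMap : ∀ c : cells, ∃ φ : EuclideanSpace ℝ (Fin (dim c)) → X,
    ContinuousOn φ (Metric.closedBall 0 1) ∧ Set.InjOn φ (Metric.closedBall 0 1) ∧
    φ '' Metric.closedBall 0 1 = c.1 ∧
    φ '' Metric.sphere 0 1 = ⋃ b : cells, ⋃ _ : b < c, b.1
  /-- `X` is the disjoint union of the open cells. -/
  existsUnique_mem : ∀ x : X, ∃! c : cells, x ∈ c.1 \ ⋃ b : cells, ⋃ _ : b < c, b.1
  /-- The cells are PL cells: the barycentric subdivision of the boundary of a `k`-cell is a PL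
  sphere of dimension `k - 1`. -/
  isPLSphere_boundary : ∀ c : cells, ∃ (label : cells ↪ ℕ) (K : PreAbstractSimplicialComplex ℕ),
    IsOrderComplex {b | b < c} label K ∧ IsPLSphere (dim c) K
  /-- Genericity: around a `k`-cell the cells fit together like the dual cells of the faces of a
  simplex with `d + 1 - k` vertices, the face with `j` vertices being dual to a cell of dimension
  `d + 1 - j`, and a larger face to a smaller cell. -/
  generic : ∀ c : cells,
    ∃ e : {b : cells // c ≤ b} ≃o {s : Finset (Fin (d + 1 - dim c)) // s.Nonempty}ᵒᵈ,
      ∀ b, dim b.1 + (OrderDual.ofDual (e b)).1.card = d + 1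

namespace GenericCellulation

variable {d : ℕ} {X : Type*} [TopologicalSpace X] (C : GenericCellulation d X)

/-- The (closed) cells. -/
abbrev Cell : Type _ := C.cells

noncomputable instance : Fintype C.Cell := C.finite_cells.fintype

noncomputable instance : DecidableEq C.Cell := Classical.decEq _

/-- There is one qubit for each cell of dimension `d - 1`. -/
abbrev Qubit : Type _ := {f : C.Cell // C.dim f + 1 = d}

/-- A basis configuration: the set `E` of those `(d-1)`-cells that are present (`↑`). -/
abbrev Config : Type _ := Finset C.Qubit

/-- Operators on the Hilbert space, the tensor product of the qubits, written as matrices in the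
product basis of configurations. States are the vectors `C.Config → ℂ`. -/
abbrev Op : Type _ := Matrix C.Config C.Config ℂ

open Classical in
/-- The Euler characteristic of the union of the closed `(d-1)`-cells in `E`: the alternating
number of the cells that this union consists of. -/
noncomputable def chi (E : C.Config) : ℤ :=
  ∑ b : C.Cell with ∃ f ∈ E, b ≤ f.1, (-1) ^ C.dim b

open Classical in
/-- The `(d-1)`-cells in the boundary of the `d`-cell `c`. -/
noncomputable def bdry (c : C.Cell) : C.Config := Finset.univ.filter (fun f => f.1 ≤ c)

open Classical in
/-- The `(d-1)`-cells that contain the `(d-2)`-cell `e` in their boundary. -/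
noncomputable def cobdry (e : C.Cell) : C.Config := Finset.univ.filter (fun f => e ≤ f.1)

/-- `∏ Z_f` over the `(d-1)`-cells `f` that contain `e`: it has the eigenvalue `1` or `-1` on a
configuration `E` according to whether an even or an odd number of these cells is in `E`. -/
noncomputable def prodZ (e : C.Cell) : C.Op :=
  Matrix.diagonal (fun E => (-1) ^ (E ∩ C.cobdry e).card)

/-- `∏ X_f` over the `(d-1)`-cells `f` in the boundary of `c`: it flips the state of these
cells. -/
noncomputable def prodX (c : C.Cell) : C.Op :=
  Matrix.of (fun F E => if F = symmDiff E (C.bdry c) then 1 else 0)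

/-- The operator `O_c = ± ∏ X_f` of the generalized double semion theory. On a configuration `E`
the sign is `-(-1)^χ(↑_c)`, where `↑_c` is the union of the `(d-1)`-cells of `∂c` in `E`. -/
noncomputable def semionO (c : C.Cell) : C.Op :=
  C.prodX c * Matrix.diagonal (fun E => -(-1 : ℂ) ^ C.chi (E ∩ C.bdry c))

open Classical in
/-- `H_+`, which is the same for both theories. -/
noncomputable def hPlus : C.Op :=
  ∑ e : C.Cell with C.dim e + 2 = d, (1 / 2 : ℂ) • (1 - C.prodZ e)

open Classical in
/-- `H_□` of the generalized double semion theory. -/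
noncomputable def hSquareGDS : C.Op :=
  ∑ c : C.Cell with C.dim c = d, (1 / 2 : ℂ) • (1 - C.semionO c)

open Classical in
/-- `H_□` of the generalized toric code, with qubits on the `(d-1)`-cells. -/
noncomputable def hSquareGTC : C.Op :=
  ∑ c : C.Cell with C.dim c = d, (1 / 2 : ℂ) • (1 - C.prodX c)

/-- The Hamiltonian of the generalized double semion theory. -/
noncomputable def hGDS : C.Op := C.hPlus + C.hSquareGDS

/-- The Hamiltonian of the generalized toric code. -/
noncomputable def hGTC : C.Op := C.hPlus + C.hSquareGTC

/-- The diagonal operator `U` that multiplies the configuration `E` by `i^χ(E)`. -/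
noncomputable def phaseU : C.Op := Matrix.diagonal (fun E => Complex.I ^ C.chi E)

/-- The local geometry of the cellulation is bounded by `K` and `D`: any `j`-cell is in the
boundary of at most `K` cells of dimension `j + 1`, any `(j+1)`-cell has at most `K` cells of
dimension `j` in its boundary, and any cell has diameter at most `D`. -/
structure BoundedGeometry {d : ℕ} {X : Type*} [MetricSpace X] (C : GenericCellulation d X)
    (K : ℕ) (D : ℝ) : Prop where
  coface_le : ∀ b : C.Cell, {c : C.Cell | b < c ∧ C.dim c = C.dim b + 1}.ncard ≤ K
  face_le : ∀ c : C.Cell, {b : C.Cell | b < c ∧ C.dim c = C.dim b + 1}.ncard ≤ K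
  diam_le : ∀ c : C.Cell, Metric.diam c.1 ≤ D

end GenericCellulation

/-! ### Ground spaces and circuits -/

/-- The (real) eigenvalues of `H`. -/
def energies {n : Type*} [Fintype n] [DecidableEq n] (H : Matrix n n ℂ) : Set ℝ :=
  {x | Module.End.HasEigenvalue (Matrix.toLin' H) (x : ℂ)}

/-- The ground space of `H`: the eigenspace for the lowest eigenvalue. -/
noncomputable def groundSpace {n : Type*} [Fintype n] [DecidableEq n] (H : Matrix n n ℂ) :
    Submodule ℂ (n → ℂ) :=
  Module.End.eigenspace (Matrix.toLin' H) ((sInf (energies H) : ℝ) : ℂ)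

/-- A gate on the qubits `Q`: a unitary of the form `A ⊗ 1`, where `A` acts on the set `support`
of qubits. -/
structure Gate (Q : Type*) [Fintype Q] [DecidableEq Q] where
  support : Finset Q
  op : Matrix (Finset Q) (Finset Q) ℂ
  unitary : op ∈ Matrix.unitaryGroup (Finset Q) ℂ
  supported : ∃ A : Finset Q → Finset Q → ℂ, ∀ F E,
    op F E = if F \ support = E \ support then A (F ∩ support) (E ∩ support) else 0

/-- A quantum circuit: a list of rounds, each of which is a list of gates. -/
abbrev Circuit (Q : Type*) [Fintype Q] [DecidableEq Q] := List (List (Gate Q))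

namespace Circuit

variable {Q : Type*} [Fintype Q] [DecidableEq Q]

/-- The gates that are performed in the same round have disjoint supports. -/
def IsParallel (P : Circuit Q) : Prop :=
  ∀ L ∈ P, L.Pairwise (fun g h => Disjoint g.support h.support)

/-- The number of rounds. -/
def depth (P : Circuit Q) : ℕ := P.length

/-- The operator that the circuit performs. -/
noncomputable def toOp (P : Circuit Q) : Matrix (Finset Q) (Finset Q) ℂ :=
  (P.map (fun L => (L.map Gate.op).prod)).prod

end Circuit

end GDS

/-! Write `F` for the flip of `E` by `∂c`. Everything rests on one identity for closed
configurations `E` (those with an even number of present cells at each `(d-2)`-cell): `χ(F) = χ(E) +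
2 - 2 χ(E ∩ ∂c)`. It gives `i^χ(F) * (-1)^χ(E ∩ ∂c) = -i^χ(E)`, so conjugation by `U` turns `O_c`
into the product of the `X_f` (`phaseU_mulVec_hSquareGDS`).

For the identity (`IsClosedConfig.chi_symmDiff`), put `A = E ∩ ∂c`, `B = ∂c \ E`, `W = E \ ∂c`. By
genericity the cells around a cell are dual to the faces of a simplex: `d`-cells are vertices,
`(d-1)`-cells edges, `(d-2)`-cells triangles. Evenness on triangles makes any two of `A`, `B`, `W`
meet in the same cells (`IsClosedConfig.closureCells_inter`). This common part behaves like a closed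
manifold of odd dimension `d - 2`, so its Euler characteristic is `0` (`sum_closureCells_inter`).
Hence `χ(E) = χ(W) + χ(A)`, `χ(F) = χ(W) + χ(B)`, and `χ(A) + χ(B) = χ(∂c) = 2`. The only input
about single cells is that a closed cell has alternating cell count `1` (`sum_le`), which follows
from invariance of the alternating face count under stellar moves.

All Hamiltonians are sums of projections, so zero-energy states are joint kernels. The sum of all
closed configurations is a toric code state of energy `0`; `U⁻¹` carries it to the double semion
side.

Finally `i^χ(E)` is a product of one phase per cell `b`, depending only on the `(d-1)`-cells
containing `b`. These gates commute, and a colouring of the cells sorts them into boundedly many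
parallel rounds. -/

namespace GDS

/-! ### The Euler characteristic of combinatorial spheres -/

/-- An alternating sum over a family of finite sets, on which toggling membership of `x` acts,
vanishes. -/
theorem sum_neg_one_pow_card_eq_zero {α : Type*} [DecidableEq α] (S : Finset (Finset α)) (x : α)
    (hS : ∀ t, t ∈ S ↔ symmDiff t {x} ∈ S) : ∑ t ∈ S, (-1 : ℤ) ^ t.card = 0 := by
  have key : ∀ t : Finset α, (-1 : ℤ) ^ t.card + (-1) ^ (symmDiff t {x}).card = 0 := by
    intro t
    by_cases hx : x ∈ t
    · have h1 : symmDiff t {x} = t.erase x := by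
        ext y; simp only [Finset.mem_symmDiff, Finset.mem_singleton, Finset.mem_erase]; grind
      rw [h1, ← Finset.card_erase_add_one hx, pow_succ]; ring
    · have h1 : symmDiff t {x} = insert x t := by
        ext y; simp only [Finset.mem_symmDiff, Finset.mem_singleton, Finset.mem_insert]; grind
      rw [h1, Finset.card_insert_of_notMem hx, pow_succ]; ring
  refine Finset.sum_involution (fun t _ => symmDiff t {x}) (fun t _ => key t) ?_
    (fun t ht => (hS t).1 ht) (fun t _ => by simp)
  intro t _ _ h
  have := congrArg (x ∈ ·) h
  simp [Finset.mem_symmDiff] at this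

theorem StellarMove.sum_eq {F F' : Finset (Finset ℕ)} {s : Finset ℕ} (hs : s.Nonempty) {a : ℕ}
    (ha : ∀ t ∈ F, a ∉ t)
    (hF : ∀ t ∈ F, ∀ u ⊆ t, u.Nonempty → u ∈ F)
    (h : ∀ u, u ∈ F' ↔ (u ∈ F ∧ ¬ s ⊆ u) ∨ ∃ t, t ∪ s ∈ F ∧ ¬ s ⊆ t ∧ u = insert a t) :
    ∑ t ∈ F', (-1 : ℤ) ^ t.card = ∑ t ∈ F, (-1 : ℤ) ^ t.card := by
  obtain ⟨x, hx⟩ := hs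
  -- `T` must contain `∅`, which produces the new vertex `{a}` but is not a face in `F`; hence the
  -- passage through powersets.
  set T : Finset (Finset ℕ) := (F.biUnion Finset.powerset).filter (fun t => t ∪ s ∈ F ∧ ¬ s ⊆ t)
    with hT
  have memT : ∀ t, t ∈ T ↔ t ∪ s ∈ F ∧ ¬ s ⊆ t := by
    intro t
    simp only [hT, Finset.mem_filter, Finset.mem_biUnion, Finset.mem_powerset, and_iff_right_iff_imp]
    exact fun h => ⟨_, h.1, Finset.subset_union_left⟩
  have haT : ∀ t ∈ T, a ∉ t := fun t ht h =>
    ha _ ((memT t).1 ht).1 (Finset.mem_union_left _ h)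
  have hF' : F' = F.filter (fun u => ¬ s ⊆ u) ∪ T.image (insert a) := by
    ext u
    rw [h, Finset.mem_union, Finset.mem_filter, Finset.mem_image]
    simp only [memT]
    grind
  have hdisj : Disjoint (F.filter (fun u => ¬ s ⊆ u)) (T.image (insert a)) := by
    rw [Finset.disjoint_left]
    intro u hu hu'
    obtain ⟨t, -, rfl⟩ := Finset.mem_image.1 hu'
    exact ha _ (Finset.mem_filter.1 hu).1 (Finset.mem_insert_self _ _)
  have hinj : Set.InjOn (insert a : Finset ℕ → Finset ℕ) T := by
    intro t ht t' ht' e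
    rw [← Finset.erase_insert (haT t ht), ← Finset.erase_insert (haT t' ht'), e]
  -- Fix `x ∈ s`. Where `s` is not inside `t ∪ {x}`, toggling `x` cancels terms in pairs. The
  -- remaining `t` omit exactly `x` from `s`, and adding `x` matches them with the deleted faces.
  have hT1 : ∑ t ∈ T.filter (fun t => ¬ s ⊆ insert x t), (-1 : ℤ) ^ t.card = 0 := by
    refine sum_neg_one_pow_card_eq_zero _ x fun t => ?_
    have e1 : symmDiff t {x} ∪ s = t ∪ s := by
      ext y; simp only [Finset.mem_symmDiff, Finset.mem_singleton, Finset.mem_union]; grind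
    have e2 : insert x (symmDiff t {x}) = insert x t := by
      ext y; simp only [Finset.mem_symmDiff, Finset.mem_singleton, Finset.mem_insert]; grind
    simp only [Finset.mem_filter, memT, e1, e2]
    constructor
    · rintro ⟨⟨h1, h2⟩, h3⟩
      exact ⟨⟨h1, fun h => h3 (e2 ▸ h.trans (Finset.subset_insert _ _))⟩, h3⟩
    · rintro ⟨⟨h1, h2⟩, h3⟩
      exact ⟨⟨h1, fun h => h3 (h.trans (Finset.subset_insert _ _))⟩, h3⟩
  have hT2 : ∑ t ∈ T.filter (fun t => s ⊆ insert x t), (-1 : ℤ) ^ (t.card + 1) =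
      ∑ t ∈ F.filter (fun t => s ⊆ t), (-1 : ℤ) ^ t.card := by
    have hxt : ∀ t ∈ T.filter (fun t => s ⊆ insert x t), x ∉ t := by
      intro t ht hxt
      rw [Finset.mem_filter, Finset.insert_eq_of_mem hxt] at ht
      exact ((memT t).1 ht.1).2 ht.2
    refine Finset.sum_bij (fun t _ => insert x t) ?_ ?_ ?_ ?_
    · intro t ht
      have ht' := Finset.mem_filter.1 ht
      refine Finset.mem_filter.2 ⟨?_, ht'.2⟩
      have := ((memT t).1 ht'.1).1
      have e : t ∪ s = insert x t := by
        apply Finset.Subset.antisymm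
        · exact Finset.union_subset (Finset.subset_insert _ _) ht'.2
        · exact Finset.insert_subset (Finset.mem_union_right _ hx) Finset.subset_union_left
      rwa [← e]
    · intro t ht t' ht' e
      rw [← Finset.erase_insert (hxt t ht), ← Finset.erase_insert (hxt t' ht'), e]
    · intro t ht
      have ht' := Finset.mem_filter.1 ht
      have e : insert x (t.erase x) = t := Finset.insert_erase (ht'.2 hx)
      refine ⟨t.erase x, Finset.mem_filter.2 ⟨(memT _).2 ⟨?_, ?_⟩, ?_⟩, e⟩
      · refine hF t ht'.1 _ (Finset.union_subset (Finset.erase_subset _ _) ht'.2)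
          ⟨x, Finset.mem_union_right _ hx⟩
      · exact fun h => Finset.notMem_erase x t (h hx)
      · rw [e]; exact ht'.2
    · intro t ht
      rw [Finset.card_insert_of_notMem (hxt t ht)]
  rw [hF', Finset.sum_union hdisj, Finset.sum_image hinj,
    ← Finset.sum_filter_add_sum_filter_not F (fun u => s ⊆ u), add_comm]
  congr 1
  rw [← Finset.sum_filter_add_sum_filter_not T (fun t => s ⊆ insert x t), ← hT2]
  have e1 : ∀ S ⊆ T, ∑ t ∈ S, (-1 : ℤ) ^ (insert a t).card = ∑ t ∈ S, (-1 : ℤ) ^ (t.card + 1) :=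
    fun S hS => Finset.sum_congr rfl fun t ht => by
      rw [Finset.card_insert_of_notMem (haT t (hS ht))]
  rw [e1 _ (Finset.filter_subset _ _), e1 _ (Finset.filter_subset _ _), add_eq_left]
  simp only [pow_succ, ← Finset.sum_mul, hT1, zero_mul]

/-- Needed so that every complex in a chain of stellar moves has a finite sum over its faces. -/
theorem StellarMove.finite_iff {K K' : PreAbstractSimplicialComplex ℕ} (h : StellarMove K K') :
    K.faces.Finite ↔ K'.faces.Finite := by
  obtain ⟨s, hs, a, ha, hK'⟩ := h
  obtain ⟨x, hx⟩ := (K.isRelLowerSet_faces hs).1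
  constructor
  · intro hf
    rw [hK']
    refine (hf.subset fun t ht => ht.1).union ?_
    refine ((hf.insert ∅).image (insert a)).subset ?_
    rintro _ ⟨t, ht, -, rfl⟩
    refine ⟨t, ?_, rfl⟩
    rcases t.eq_empty_or_nonempty with h | h
    · exact Or.inl h
    · exact Or.inr ((K.isRelLowerSet_faces ht).2 Finset.subset_union_left h)
  · intro hf
    -- A deleted face is recovered from the new face obtained by replacing `x` with `a`.
    have h1 : {t | t ∈ K.faces ∧ s ⊆ t}.Finite := by
      refine Set.Finite.of_finite_image (f := fun t => insert a (t.erase x)) (hf.subset ?_) ?_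
      · rintro _ ⟨t, ⟨ht, hst⟩, rfl⟩
        rw [hK']
        refine Or.inr ⟨t.erase x, ?_, fun h => Finset.notMem_erase x t (h hx), rfl⟩
        exact (K.isRelLowerSet_faces ht).2 (Finset.union_subset (Finset.erase_subset _ _) hst)
          ⟨x, Finset.mem_union_right _ hx⟩
      · intro t ht t' ht' e
        have hat : a ∉ t.erase x := fun h => ha t ht.1 (Finset.mem_of_mem_erase h)
        have hat' : a ∉ t'.erase x := fun h => ha t' ht'.1 (Finset.mem_of_mem_erase h)
        have e' : t.erase x = t'.erase x := by
          rw [← Finset.erase_insert hat, ← Finset.erase_insert hat']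
          exact congrArg (fun u => Finset.erase u a) e
        rw [← Finset.insert_erase (ht.2 hx), e', Finset.insert_erase (ht'.2 hx)]
    refine (h1.union (Set.Finite.subset (t := {t | t ∈ K.faces ∧ ¬ s ⊆ t}) hf ?_)).subset ?_
    · rw [hK']; exact Set.subset_union_left
    · intro t ht
      by_cases h : s ⊆ t
      · exact Or.inl ⟨ht, h⟩
      · exact Or.inr ⟨ht, h⟩

/-- The reduced Euler characteristic, up to sign and without the empty face, is preserved under
stellar moves. -/
theorem StellarMove.finsum_eq {K K' : PreAbstractSimplicialComplex ℕ} (h : StellarMove K K')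
    {F F' : Finset (Finset ℕ)} (hF : (F : Set (Finset ℕ)) = K.faces)
    (hF' : (F' : Set (Finset ℕ)) = K'.faces) :
    ∑ t ∈ F', (-1 : ℤ) ^ t.card = ∑ t ∈ F, (-1 : ℤ) ^ t.card := by
  obtain ⟨s, hs, a, ha, hK'⟩ := h
  have m : ∀ t, t ∈ K.faces ↔ t ∈ F := fun t => by rw [← hF, Finset.mem_coe]
  refine StellarMove.sum_eq (K.isRelLowerSet_faces hs).1 (fun t ht => ha t ((m t).2 ht))
    (fun t ht u hut hu => (m u).1 ((K.isRelLowerSet_faces ((m t).2 ht)).2 hut hu)) (a := a) ?_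
  intro u
  rw [← Finset.mem_coe, hF', hK']
  simp only [Set.mem_union, Set.mem_ofPred_eq, m]

theorem sum_simplexBoundary (k : ℕ) {F : Finset (Finset ℕ)}
    (hF : (F : Set (Finset ℕ)) = (simplexBoundary k).faces) :
    ∑ t ∈ F, (-1 : ℤ) ^ t.card = (-1) ^ k - 1 := by
  have h : F = ((Finset.range (k + 1)).powerset.erase (Finset.range (k + 1))).erase ∅ := by
    ext t
    rw [← Finset.mem_coe, hF]
    simp [simplexBoundary, Finset.ssubset_iff_subset_ne, Finset.nonempty_iff_ne_empty, and_comm]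
  have h0 := Finset.sum_powerset_neg_one_pow_card_of_nonempty
    (x := Finset.range (k + 1)) (by simp)
  have h1 := Finset.sum_erase_eq_sub (f := fun t : Finset ℕ => (-1 : ℤ) ^ t.card)
    (Finset.mem_powerset_self (Finset.range (k + 1)))
  have h2 := Finset.sum_erase_eq_sub (f := fun t : Finset ℕ => (-1 : ℤ) ^ t.card)
    (a := ∅) (s := (Finset.range (k + 1)).powerset.erase (Finset.range (k + 1)))
    (by simpa using (Finset.nonempty_range_iff.2 k.succ_ne_zero).ne_empty.symm)
  rw [h, h2, h1, h0]
  simp [pow_succ]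

theorem IsPLSphere.sum_eq {k : ℕ} {K : PreAbstractSimplicialComplex ℕ} (h : IsPLSphere k K)
    {F : Finset (Finset ℕ)} (hF : (F : Set (Finset ℕ)) = K.faces) :
    ∑ t ∈ F, (-1 : ℤ) ^ t.card = (-1) ^ k - 1 := by
  have key : ∀ K K' : PreAbstractSimplicialComplex ℕ, Relation.EqvGen StellarMove K K' →
      (K.faces.Finite ↔ K'.faces.Finite) ∧ ∀ F F' : Finset (Finset ℕ),
        (F : Set (Finset ℕ)) = K.faces → (F' : Set (Finset ℕ)) = K'.faces →
        ∑ t ∈ F', (-1 : ℤ) ^ t.card = ∑ t ∈ F, (-1 : ℤ) ^ t.card := by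
    intro K K' h
    induction h with
    | rel K K' h => exact ⟨h.finite_iff, fun F F' hF hF' => h.finsum_eq hF hF'⟩
    | refl K =>
      refine ⟨Iff.rfl, fun F F' hF hF' => ?_⟩
      rw [Finset.coe_injective (hF.trans hF'.symm)]
    | symm K K' _ ih => exact ⟨ih.1.symm, fun F F' hF hF' => (ih.2 F' F hF' hF).symm⟩
    | trans K K' K'' _ _ ih ih' =>
      refine ⟨ih.1.trans ih'.1, fun F F' hF hF' => ?_⟩
      have hfin : K'.faces.Finite := ih.1.1 (hF ▸ F.finite_toSet)
      rw [ih'.2 hfin.toFinset F' hfin.coe_toFinset hF', ih.2 F _ hF hfin.coe_toFinset]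
  obtain ⟨h1, h2⟩ := key _ _ h
  have hfin : (simplexBoundary k).faces.Finite := h1.2 (hF ▸ F.finite_toSet)
  rw [h2 hfin.toFinset F hfin.coe_toFinset hF, sum_simplexBoundary k hfin.coe_toFinset]


namespace GenericCellulation

variable {d : ℕ} {X : Type*} [TopologicalSpace X] (C : GenericCellulation d X)

/-! ### The Euler characteristic of a cell -/

open Classical in
/-- The nonempty chains of proper faces of `c`. -/
noncomputable def chainsBelow (c : C.Cell) : Finset (Finset C.Cell) :=
  Finset.univ.filter fun t => t.Nonempty ∧ (t : Set C.Cell) ⊆ {b | b < c} ∧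
    IsChain (· ≤ ·) (t : Set C.Cell)

theorem sum_chainsBelow (c : C.Cell) :
    ∑ t ∈ C.chainsBelow c, (-1 : ℤ) ^ t.card = (-1) ^ C.dim c - 1 := by
  obtain ⟨label, K, hK, hS⟩ := C.isPLSphere_boundary c
  rw [← hS.sum_eq (F := (C.chainsBelow c).image (Finset.map label)),
    Finset.sum_image ((Finset.map_injective label).injOn)]
  · simp
  · rw [hK]
    ext s
    simp only [chainsBelow, Finset.coe_image, Set.mem_image, Finset.mem_coe, Finset.mem_filter,
      Finset.mem_univ, true_and, Set.mem_ofPred_eq, and_assoc, eq_comm]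

-- Sorting chains by their top element is what allows a count of chains to be turned into a count of
-- cells.
open Classical in
theorem chainsBelow_eq_biUnion (c : C.Cell) :
    C.chainsBelow c = (Finset.univ.filter (· < c)).biUnion
      fun b => (insert ∅ (C.chainsBelow b)).image (insert b) := by
  ext t
  simp only [Finset.mem_biUnion, Finset.mem_filter, Finset.mem_univ, true_and, Finset.mem_image,
    Finset.mem_insert]
  constructor
  · intro ht
    simp only [chainsBelow, Finset.mem_filter, Finset.mem_univ, true_and] at ht
    obtain ⟨hne, hsub, hch⟩ := ht
    obtain ⟨b, hb⟩ := t.exists_maximal hne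
    have hlt : ∀ b' ∈ t.erase b, b' < b := by
      intro b' hb'
      obtain ⟨hne', hm'⟩ := Finset.mem_erase.1 hb'
      rcases hch hm' hb.1 hne' with h | h
      · exact lt_of_le_of_ne h hne'
      · exact absurd (le_antisymm (hb.2 hm' h) h) hne'
    refine ⟨b, hsub hb.1, t.erase b, ?_, Finset.insert_erase hb.1⟩
    rcases (t.erase b).eq_empty_or_nonempty with h | h
    · exact Or.inl h
    · refine Or.inr (Finset.mem_filter.2 ⟨Finset.mem_univ _, h, fun b' hb' => hlt b' hb', ?_⟩)
      exact hch.mono (Finset.coe_subset.2 (Finset.erase_subset _ _))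
  · rintro ⟨b, hb, t, ht, rfl⟩
    refine Finset.mem_filter.2 ⟨Finset.mem_univ _, Finset.insert_nonempty _ _, ?_⟩
    rcases ht with rfl | ht
    · simpa using hb
    · obtain ⟨-, hne, hsub, hch⟩ := Finset.mem_filter.1 ht
      rw [Finset.coe_insert]
      refine ⟨Set.insert_subset hb fun b' hb' => (hsub hb').trans hb, hch.insert ?_⟩
      intro b' hb' _
      exact Or.inr (hsub hb').le

open Classical in
/-- The Euler characteristic of the boundary sphere of a cell. -/
theorem sum_lt (c : C.Cell) :
    ∑ b : C.Cell with b < c, (-1 : ℤ) ^ C.dim b = 1 - (-1) ^ C.dim c := by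
  have hlt : ∀ b : C.Cell, ∀ t ∈ insert ∅ (C.chainsBelow b), ∀ b' ∈ t, b' < b := by
    intro b t ht b' hb'
    rcases Finset.mem_insert.1 ht with rfl | ht
    · simp at hb'
    · exact (Finset.mem_filter.1 ht).2.2.1 hb'
  have h := C.sum_chainsBelow c
  rw [chainsBelow_eq_biUnion, Finset.sum_biUnion] at h
  -- The chains with top `b` contribute `-(1 + ((-1)^dim b - 1)) = -(-1)^dim b`, so no induction on
  -- the dimension is needed.
  · rw [← neg_inj, neg_sub, ← h, ← Finset.sum_neg_distrib]
    refine Finset.sum_congr rfl fun b _ => ?_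
    have hb : ∀ t ∈ insert ∅ (C.chainsBelow b), b ∉ t := fun t ht h => (hlt b t ht b h).false
    rw [Finset.sum_image]
    · rw [Finset.sum_congr rfl fun t ht => by
        rw [Finset.card_insert_of_notMem (hb t ht), pow_succ], ← Finset.sum_mul,
        Finset.sum_insert, sum_chainsBelow]
      · simp
      · simp [chainsBelow]
    · intro t ht t' ht' e
      rw [← Finset.erase_insert (hb t ht), ← Finset.erase_insert (hb t' ht'), e]
  · intro b _ b' _ hne
    rw [Function.onFun, Finset.disjoint_left]
    intro u hu hu'
    obtain ⟨t, ht, rfl⟩ := Finset.mem_image.1 hu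
    obtain ⟨t', ht', e⟩ := Finset.mem_image.1 hu'
    have h1 : b' ∈ insert b t := e ▸ Finset.mem_insert_self b' t'
    have h2 : b ∈ insert b' t' := e ▸ Finset.mem_insert_self b t
    have h1' := hlt b t ht b' ((Finset.mem_insert.1 h1).resolve_left hne.symm)
    have h2' := hlt b' t' ht' b ((Finset.mem_insert.1 h2).resolve_left hne)
    exact lt_asymm h1' h2'

open Classical in
/-- The Euler characteristic of a closed cell. -/
theorem sum_le (c : C.Cell) : ∑ b : C.Cell with b ≤ c, (-1 : ℤ) ^ C.dim b = 1 := by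
  have h : Finset.univ.filter (fun b : C.Cell => b ≤ c) =
      insert c (Finset.univ.filter fun b : C.Cell => b < c) := by
    ext b; simp [le_iff_eq_or_lt]
  rw [h, Finset.sum_insert (by simp), sum_lt]
  ring

/-! ### The cells around a cell -/

/-- A description of the cells around `b` as dual to the nonempty faces of a simplex: `up s` is the
cell dual to the face `s`. -/
structure LocalModel (b : C.Cell) where
  /-- the cell dual to a face -/
  up : Finset (Fin (d + 1 - C.dim b)) → C.Cell
  le_up : ∀ s, s.Nonempty → b ≤ up s
  dim_up : ∀ s, s.Nonempty → C.dim (up s) + s.card = d + 1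
  up_le_up : ∀ s t, s.Nonempty → t.Nonempty → (up s ≤ up t ↔ t ⊆ s)
  exists_up : ∀ b', b ≤ b' → ∃ s, s.Nonempty ∧ up s = b'

theorem nonempty_localModel (b : C.Cell) : Nonempty (C.LocalModel b) := by
  classical
  obtain ⟨e, he⟩ := C.generic b
  let g : {s : Finset (Fin (d + 1 - C.dim b)) // s.Nonempty} → {b' : C.Cell // b ≤ b'} :=
    fun s => e.symm (OrderDual.toDual s)
  have hg : ∀ s, OrderDual.ofDual (e (g s)) = s := fun s => by simp [g]
  -- The empty face is dual to no cell; `b` is a default value there.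
  let up : Finset (Fin (d + 1 - C.dim b)) → C.Cell := fun s => if h : s.Nonempty then g ⟨s, h⟩ else b
  have hup : ∀ s (h : s.Nonempty), up s = g ⟨s, h⟩ := fun s h => by simp [up, h]
  refine ⟨⟨up, ?_, ?_, ?_, ?_⟩⟩
  · intro s hs; rw [hup s hs]; exact (g ⟨s, hs⟩).2
  · intro s hs
    have := he (g ⟨s, hs⟩)
    rw [hg] at this
    rw [hup s hs]; exact this
  · intro s t hs ht
    rw [hup s hs, hup t ht, Subtype.coe_le_coe, ← e.le_iff_le, ← OrderDual.ofDual_le_ofDual, hg, hg]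
    rfl
  · intro b' hb'
    refine ⟨(OrderDual.ofDual (e ⟨b', hb'⟩)).1, (OrderDual.ofDual (e ⟨b', hb'⟩)).2, ?_⟩
    rw [hup _ (OrderDual.ofDual (e ⟨b', hb'⟩)).2]
    simp [g]

theorem dim_le (b : C.Cell) : C.dim b ≤ d := by
  obtain ⟨M⟩ := C.nonempty_localModel b
  obtain ⟨s, hs, h⟩ := M.exists_up b le_rfl
  have := M.dim_up s hs
  have := hs.card_pos
  rw [h] at *
  lia

namespace LocalModel

variable {C} {b : C.Cell} (M : C.LocalModel b)

theorem up_injOn {s t : Finset (Fin (d + 1 - C.dim b))} (hs : s.Nonempty) (ht : t.Nonempty)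
    (h : M.up s = M.up t) : s = t :=
  Finset.Subset.antisymm ((M.up_le_up t s ht hs).1 h.ge) ((M.up_le_up s t hs ht).1 h.le)

/-- The `(d-1)`-cell dual to an edge. -/
def qubit (x y : Fin (d + 1 - C.dim b)) (h : x ≠ y) : C.Qubit :=
  ⟨M.up {x, y}, by
    have := M.dim_up {x, y} (Finset.insert_nonempty _ _)
    rw [Finset.card_pair h] at this; lia⟩

theorem qubit_comm (x y : Fin (d + 1 - C.dim b)) (h : x ≠ y) :
    M.qubit x y h = M.qubit y x h.symm := by
  simp only [qubit, Finset.pair_comm x y]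

theorem up_le_qubit_iff {s : Finset (Fin (d + 1 - C.dim b))} (hs : s.Nonempty)
    (x y : Fin (d + 1 - C.dim b)) (h : x ≠ y) : M.up s ≤ (M.qubit x y h).1 ↔ x ∈ s ∧ y ∈ s := by
  rw [qubit, M.up_le_up _ _ hs (Finset.insert_nonempty _ _), Finset.insert_subset_iff,
    Finset.singleton_subset_iff]

theorem le_qubit (x y : Fin (d + 1 - C.dim b)) (h : x ≠ y) : b ≤ (M.qubit x y h).1 :=
  M.le_up _ (Finset.insert_nonempty _ _)

theorem qubit_le_iff (x y v : Fin (d + 1 - C.dim b)) (h : x ≠ y) :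
    (M.qubit x y h).1 ≤ M.up {v} ↔ v = x ∨ v = y := by
  rw [qubit, M.up_le_up _ _ (Finset.insert_nonempty _ _) (Finset.singleton_nonempty v),
    Finset.singleton_subset_iff, Finset.mem_insert, Finset.mem_singleton]

theorem exists_qubit (f : C.Qubit) (hf : b ≤ f.1) : ∃ x y h, f = M.qubit x y h := by
  obtain ⟨s, hs, e⟩ := M.exists_up f.1 hf
  have h1 := M.dim_up s hs
  have h2 := f.2
  rw [e] at h1
  obtain ⟨x, y, h, rfl⟩ := Finset.card_eq_two.1 (show s.card = 2 by lia)
  exact ⟨x, y, h, Subtype.ext e.symm⟩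

theorem exists_up_singleton (c : C.Cell) (hc : C.dim c = d) (hb : b ≤ c) : ∃ v, c = M.up {v} := by
  obtain ⟨s, hs, e⟩ := M.exists_up c hb
  have h1 := M.dim_up s hs
  rw [e] at h1
  obtain ⟨v, rfl⟩ := Finset.card_eq_one.1 (show s.card = 1 by lia)
  exact ⟨v, e.symm⟩

theorem exists_qubit_of_le (f : C.Qubit) (hf : b ≤ f.1) {v} (hv : f.1 ≤ M.up {v}) :
    ∃ x, ∃ h : v ≠ x, f = M.qubit v x h := by
  obtain ⟨x, y, h, rfl⟩ := M.exists_qubit f hf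
  rcases (M.qubit_le_iff x y v h).1 hv with rfl | rfl
  · exact ⟨y, h, rfl⟩
  · exact ⟨x, h.symm, M.qubit_comm _ _ _⟩

end LocalModel

/-! ### Closed configurations -/

/-- The `(d-2)`-cells are in an even number of cells of `E`. -/
def IsClosedConfig (E : C.Config) : Prop :=
  ∀ e, C.dim e + 2 = d → Even (E ∩ C.cobdry e).card

theorem mem_cobdry {e : C.Cell} {f : C.Qubit} : f ∈ C.cobdry e ↔ e ≤ f.1 := by simp [cobdry]

theorem mem_bdry {c : C.Cell} {f : C.Qubit} : f ∈ C.bdry c ↔ f.1 ≤ c := by simp [bdry]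

/-- This turns closedness of a configuration into a parity condition on the three edges of each
triangle of the dual simplex. -/
theorem LocalModel.cobdry_triple {C : GenericCellulation d X} {b : C.Cell} (M : C.LocalModel b)
    {x y z : Fin (d + 1 - C.dim b)} (hxy : x ≠ y) (hxz : x ≠ z) (hyz : y ≠ z) :
    C.cobdry (M.up {x, y, z}) = {M.qubit x y hxy, M.qubit x z hxz, M.qubit y z hyz} := by
  ext f
  rw [mem_cobdry]
  constructor
  · intro h
    obtain ⟨u, w, huw, rfl⟩ := M.exists_qubit f ((M.le_up _ (Finset.insert_nonempty _ _)).trans h)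
    rw [M.up_le_qubit_iff (Finset.insert_nonempty _ _)] at h
    simp only [Finset.mem_insert, Finset.mem_singleton] at h ⊢
    obtain ⟨rfl | rfl | rfl, rfl | rfl | rfl⟩ := h <;>
      first | exact absurd rfl huw | simp | simp [M.qubit_comm u w huw]
  · simp only [Finset.mem_insert, Finset.mem_singleton]
    rintro (rfl | rfl | rfl) <;> rw [M.up_le_qubit_iff (Finset.insert_nonempty _ _)] <;> simp

theorem LocalModel.qubit_ne {C : GenericCellulation d X} {b : C.Cell} (M : C.LocalModel b)
    {x y z : Fin (d + 1 - C.dim b)} (hxy : x ≠ y) (hxz : x ≠ z) (hyz : y ≠ z) :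
    M.qubit x y hxy ≠ M.qubit x z hxz := by
  intro e
  have := (M.qubit_le_iff x z y hxz).1 (e ▸ (M.qubit_le_iff x y y hxy).2 (Or.inr rfl))
  grind

theorem dim_triple {C : GenericCellulation d X} {b : C.Cell} (M : C.LocalModel b)
    {x y z : Fin (d + 1 - C.dim b)} (hxy : x ≠ y) (hxz : x ≠ z) (hyz : y ≠ z) :
    C.dim (M.up {x, y, z}) + 2 = d := by
  have := M.dim_up {x, y, z} (Finset.insert_nonempty _ _)
  rw [Finset.card_eq_three.2 ⟨x, y, z, hxy, hxz, hyz, rfl⟩] at this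
  lia

theorem even_card_inter_triple {α : Type*} [DecidableEq α] (E : Finset α) {p q r : α}
    (hpq : p ≠ q) (hpr : p ≠ r) (hqr : q ≠ r) :
    Even (E ∩ {p, q, r}).card ↔ (p ∈ E ↔ ¬ (q ∈ E ↔ r ∈ E)) := by
  rw [Finset.inter_comm, ← Finset.filter_mem_eq_inter]
  by_cases hp : p ∈ E <;> by_cases hq : q ∈ E <;> by_cases hr : r ∈ E <;>
    simp [Finset.filter_insert, Finset.filter_singleton, hp, hq, hr, hpq, hpr, hqr] <;> decide

/-- Around any cell, a closed configuration is a cut of the complete graph. -/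
theorem IsClosedConfig.triple {C : GenericCellulation d X} {E : C.Config} (hE : C.IsClosedConfig E)
    {b : C.Cell} (M : C.LocalModel b)
    {x y z : Fin (d + 1 - C.dim b)} (hxy : x ≠ y) (hxz : x ≠ z) (hyz : y ≠ z) :
    M.qubit x y hxy ∈ E ↔ ¬ (M.qubit x z hxz ∈ E ↔ M.qubit y z hyz ∈ E) := by
  have h := hE _ (dim_triple M hxy hxz hyz)
  rw [M.cobdry_triple hxy hxz hyz] at h
  refine (even_card_inter_triple E (M.qubit_ne hxy hxz hyz) ?_ ?_).1 h
  · rw [M.qubit_comm x y]; exact M.qubit_ne _ _ hxz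
  · rw [M.qubit_comm x z, M.qubit_comm y z]; exact M.qubit_ne _ _ hxy

end GenericCellulation

namespace GenericCellulation

variable {d : ℕ} {X : Type*} [TopologicalSpace X] (C : GenericCellulation d X)

/-! ### Euler characteristics of configurations -/

open Classical in
/-- The cells of the union of the closed cells in `E`. -/
noncomputable def closureCells (E : C.Config) : Finset C.Cell :=
  Finset.univ.filter fun b => ∃ f ∈ E, b ≤ f.1

theorem mem_closureCells {E : C.Config} {b : C.Cell} :
    b ∈ C.closureCells E ↔ ∃ f ∈ E, b ≤ f.1 := by simp [closureCells]

theorem chi_eq (E : C.Config) : C.chi E = ∑ b ∈ C.closureCells E, (-1) ^ C.dim b := rfl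

theorem closureCells_union (E F : C.Config) :
    C.closureCells (E ∪ F) = C.closureCells E ∪ C.closureCells F := by
  ext b
  simp only [mem_closureCells, Finset.mem_union]
  grind

theorem chi_union (E F : C.Config) :
    C.chi (E ∪ F) + ∑ b ∈ C.closureCells E ∩ C.closureCells F, (-1) ^ C.dim b =
      C.chi E + C.chi F := by
  rw [chi_eq, closureCells_union, Finset.sum_union_inter]; rfl

/-- Every proper face `b` of `c` lies on a facet: `c` is a vertex of the simplex dual to `b`, and
any edge at that vertex is such a facet. So the cells counted are those of the boundary sphere. -/
theorem chi_bdry (hd : Odd d) {c : C.Cell} (hc : C.dim c = d) : C.chi (C.bdry c) = 2 := by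
  classical
  have h := C.sum_lt c
  rw [hc, hd.neg_one_pow] at h
  rw [chi_eq, ← show (1 : ℤ) - -1 = 2 by norm_num, ← h]
  refine Finset.sum_congr ?_ fun _ _ => rfl
  ext b
  rw [mem_closureCells, Finset.mem_filter, and_iff_right (Finset.mem_univ _)]
  constructor
  · rintro ⟨f, hf, hbf⟩
    refine lt_of_le_of_ne (hbf.trans (C.mem_bdry.1 hf)) ?_
    rintro rfl
    have h1 := f.2
    rw [le_antisymm (C.mem_bdry.1 hf) hbf] at h1
    lia
  · intro hb
    obtain ⟨M⟩ := C.nonempty_localModel b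
    obtain ⟨v, rfl⟩ := M.exists_up_singleton c hc hb.le
    have hx : ∃ x, v ≠ x := by
      by_contra! hv
      obtain ⟨s, hs, e⟩ := M.exists_up b le_rfl
      have : s = {v} := hs.subset_singleton_iff.1 fun y _ => by simp [hv y]
      rw [this] at e
      exact hb.ne e.symm
    obtain ⟨x, hx⟩ := hx
    exact ⟨M.qubit v x hx, C.mem_bdry.2 ((M.qubit_le_iff _ _ _ _).2 (Or.inl rfl)), M.le_qubit _ _ _⟩

/-- A closed set of cells in which the links of all cells have the Euler characteristic of an
even-dimensional sphere has Euler characteristic zero. -/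
theorem sum_eq_zero_of_link (S : Finset C.Cell) [DecidableLE C.Cell]
    (hS : ∀ b b', b ≤ b' → b' ∈ S → b ∈ S)
    (hlink : ∀ b ∈ S, ∑ b' ∈ S with b ≤ b', (-1 : ℤ) ^ C.dim b' = -1) :
    ∑ b ∈ S, (-1 : ℤ) ^ C.dim b = 0 := by
  -- Count pairs `b ≤ b'` with sign in two ways: summing over the faces of `b'` first gives `χ`,
  -- summing over the cells above `b` first gives `-χ`.
  have h1 : ∑ b ∈ S, ∑ b' ∈ S with b ≤ b', (-1 : ℤ) ^ C.dim b' * (-1) ^ C.dim b =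
      ∑ b' ∈ S, ∑ b ∈ S with b ≤ b', (-1 : ℤ) ^ C.dim b' * (-1) ^ C.dim b := by
    refine Finset.sum_comm' fun b b' => ?_
    simp only [Finset.mem_filter]
    tauto
  have h2 : ∀ b' ∈ S, ∑ b ∈ S with b ≤ b', (-1 : ℤ) ^ C.dim b' * (-1) ^ C.dim b =
      (-1 : ℤ) ^ C.dim b' := by
    intro b' hb'
    rw [← Finset.mul_sum]
    have h := C.sum_le b'
    have e : S.filter (· ≤ b') = Finset.univ.filter (· ≤ b') := by
      ext b
      simp only [Finset.mem_filter, Finset.mem_univ, true_and, and_iff_right_iff_imp]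
      exact fun hb => hS b b' hb hb'
    rw [e]
    convert mul_one _
    convert h
  rw [Finset.sum_congr rfl h2, Finset.sum_congr rfl fun b hb => by
    rw [← Finset.sum_mul, hlink b hb, neg_one_mul], Finset.sum_neg_distrib] at h1
  linarith

theorem sum_Icc_singleton_neg_one_pow_card {α : Type*} [DecidableEq α] {v : α} {W : Finset α}
    (hW : ∃ w ∈ W, w ≠ v) : ∑ s ∈ Finset.Icc {v} W, (-1 : ℤ) ^ s.card = 0 := by
  obtain ⟨w, hw, hwv⟩ := hW
  refine sum_neg_one_pow_card_eq_zero _ w fun t => ?_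
  simp only [Finset.mem_Icc, Finset.subset_iff, Finset.mem_symmDiff,
    Finset.mem_singleton]
  grind

/-- Inclusion-exclusion among the sets containing `v`: all of them, those without a `P`-vertex other
than `v`, and those without a non-`P` one each sum to `0`. Only the overlap `{v}` of the last two
survives, with sign `-1`. -/
theorem sum_meeting_neg_one_pow_card {α : Type*} [DecidableEq α] [Fintype α] {v : α}
    (P : α → Prop) (hp : ∃ p, p ≠ v ∧ P p) (hq : ∃ q, q ≠ v ∧ ¬ P q) {S : Finset (Finset α)}
    (hS : ∀ s, s ∈ S ↔ v ∈ s ∧ (∃ x ∈ s, x ≠ v ∧ P x) ∧ ∃ y ∈ s, y ≠ v ∧ ¬ P y) :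
    ∑ s ∈ S, (-1 : ℤ) ^ s.card = -1 := by
  classical
  obtain ⟨p, hpv, hp⟩ := hp
  obtain ⟨q, hqv, hq⟩ := hq
  set A := Finset.Icc {v} (Finset.univ.filter fun x => x = v ∨ ¬ P x) with hA
  set B := Finset.Icc {v} (Finset.univ.filter fun x => x = v ∨ P x) with hB
  set T := Finset.Icc {v} (Finset.univ : Finset α) with hT
  have sA : ∑ s ∈ A, (-1 : ℤ) ^ s.card = 0 :=
    sum_Icc_singleton_neg_one_pow_card ⟨q, by simp [hq], hqv⟩
  have sB : ∑ s ∈ B, (-1 : ℤ) ^ s.card = 0 :=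
    sum_Icc_singleton_neg_one_pow_card ⟨p, by simp [hp], hpv⟩
  have sT : ∑ s ∈ T, (-1 : ℤ) ^ s.card = 0 :=
    sum_Icc_singleton_neg_one_pow_card ⟨p, by simp, hpv⟩
  have hAB : A ∩ B = {{v}} := by
    ext s
    simp only [hA, hB, Finset.mem_inter, Finset.mem_Icc, Finset.subset_iff,
      Finset.mem_singleton, Finset.mem_filter, Finset.mem_univ, true_and, Finset.ext_iff]
    grind
  have hsub : A ∪ B ⊆ T := by
    refine Finset.union_subset ?_ ?_ <;>
      exact Finset.Icc_subset_Icc_right (Finset.subset_univ _)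
  have e : S = T \ (A ∪ B) := by
    ext s
    simp only [hS, hA, hB, hT, Finset.mem_sdiff, Finset.mem_union, Finset.mem_Icc,
      Finset.subset_iff,
      Finset.mem_singleton, Finset.mem_filter, Finset.mem_univ, true_and]
    grind
  have h1 := Finset.sum_sdiff (f := fun s : Finset α => (-1 : ℤ) ^ s.card) hsub
  have h2 := Finset.sum_union_inter (s₁ := A) (s₂ := B) (f := fun s : Finset α => (-1 : ℤ) ^ s.card)
  rw [hAB, Finset.sum_singleton, Finset.card_singleton] at h2
  rw [e]
  linarith

/-- A set of cells of the boundary sphere of a `d`-cell and the complementary set meet in a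
manifold of dimension `d - 2`, and its Euler characteristic is zero as `d` is odd. -/
theorem sum_closureCells_inter (hd : Odd d) {c : C.Cell} (hc : C.dim c = d) (E : C.Config) :
    ∑ b ∈ C.closureCells (E ∩ C.bdry c) ∩ C.closureCells (C.bdry c \ E), (-1 : ℤ) ^ C.dim b = 0 := by
  classical
  refine C.sum_eq_zero_of_link _ ?_ ?_
  · intro b b' hb
    simp only [Finset.mem_inter, mem_closureCells]
    rintro ⟨⟨f, hf, hbf⟩, g, hg, hbg⟩
    exact ⟨⟨f, hf, hb.trans hbf⟩, g, hg, hb.trans hbg⟩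
  · intro b hb
    obtain ⟨M⟩ := C.nonempty_localModel b
    have hbc : b ≤ c := by
      obtain ⟨f, hf, hbf⟩ := C.mem_closureCells.1 (Finset.mem_inter.1 hb).1
      exact hbf.trans (C.mem_bdry.1 (Finset.mem_inter.1 hf).2)
    obtain ⟨v, rfl⟩ := M.exists_up_singleton c hc hbc
    -- The vertex `v` is `c` itself; `P` marks the `d`-cells across a present wall of `c`. A face
    -- lies in the common part when it contains `v`, a marked vertex and another unmarked one.
    let P : Fin (d + 1 - C.dim b) → Prop := fun x => ∃ h : v ≠ x, M.qubit v x h ∈ E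
    have key : ∀ s : Finset (Fin (d + 1 - C.dim b)), s.Nonempty →
        (M.up s ∈ C.closureCells (E ∩ C.bdry (M.up {v})) ∩ C.closureCells (C.bdry (M.up {v}) \ E) ↔
          v ∈ s ∧ (∃ x ∈ s, x ≠ v ∧ P x) ∧ ∃ y ∈ s, y ≠ v ∧ ¬ P y) := by
      intro s hs
      simp only [Finset.mem_inter, mem_closureCells, Finset.mem_sdiff, mem_bdry]
      constructor
      · rintro ⟨⟨f, ⟨hf, hf'⟩, hsf⟩, g, ⟨hg', hg⟩, hsg⟩
        obtain ⟨x, hx, rfl⟩ := M.exists_qubit_of_le f ((M.le_up s hs).trans hsf) hf'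
        obtain ⟨y, hy, rfl⟩ := M.exists_qubit_of_le g ((M.le_up s hs).trans hsg) hg'
        rw [M.up_le_qubit_iff hs] at hsf hsg
        exact ⟨hsf.1, ⟨x, hsf.2, hx.symm, hx, hf⟩, y, hsg.2, hy.symm, fun ⟨_, h⟩ => hg h⟩
      · rintro ⟨hv, ⟨x, hx, -, hxv, hxE⟩, y, hy, hyv, hyE⟩
        refine ⟨⟨_, ⟨hxE, (M.qubit_le_iff _ _ _ _).2 (Or.inl rfl)⟩,
          (M.up_le_qubit_iff hs _ _ _).2 ⟨hv, hx⟩⟩, M.qubit v y hyv.symm,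
          ⟨(M.qubit_le_iff _ _ _ _).2 (Or.inl rfl), fun h => hyE ⟨_, h⟩⟩,
          (M.up_le_qubit_iff hs _ _ _).2 ⟨hv, hy⟩⟩
    obtain ⟨s, hs, e⟩ := M.exists_up b le_rfl
    obtain ⟨-, ⟨x, -, hx⟩, y, -, hy⟩ := (key s hs).1 (by rw [e]; exact hb)
    refine Eq.trans (Eq.symm ?_) (sum_meeting_neg_one_pow_card P ⟨x, hx⟩ ⟨y, hy⟩
      (S := Finset.univ.filter fun s => v ∈ s ∧ (∃ x ∈ s, x ≠ v ∧ P x) ∧ ∃ y ∈ s, y ≠ v ∧ ¬ P y)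
      fun s => by rw [Finset.mem_filter, and_iff_right (Finset.mem_univ _)])
    refine Finset.sum_bij (fun s _ => M.up s) ?_ ?_ ?_ ?_
    · intro s hs
      have hs := (Finset.mem_filter.1 hs).2
      have hne : s.Nonempty := ⟨v, hs.1⟩
      exact Finset.mem_filter.2 ⟨(key s hne).2 hs, M.le_up s hne⟩
    · intro s hs t ht h
      exact M.up_injOn ⟨v, (Finset.mem_filter.1 hs).2.1⟩ ⟨v, (Finset.mem_filter.1 ht).2.1⟩ h
    · intro b' hb'
      obtain ⟨hb'S, hbb'⟩ := Finset.mem_filter.1 hb'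
      obtain ⟨s, hs, rfl⟩ := M.exists_up b' hbb'
      exact ⟨s, Finset.mem_filter.2 ⟨Finset.mem_univ _, (key s hs).1 hb'S⟩, rfl⟩
    · intro s hs
      have h := M.dim_up s ⟨v, (Finset.mem_filter.1 hs).2.1⟩
      -- Since `d + 1` is even, a cell and its dual face carry the same sign.
      have h2 : (-1 : ℤ) ^ (C.dim (M.up s) + s.card) = 1 := by
        rw [h]; exact hd.add_one.neg_one_pow
      rw [pow_add] at h2
      rcases neg_one_pow_eq_or ℤ (C.dim (M.up s)) with h3 | h3 <;> rw [h3] at h2 ⊢ <;> linarith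

/-- Besides its role in the flip formula, this shows that the sign in `O_c` does not change under
the flip, so that `O_c` is Hermitian. -/
theorem chi_inter_add_chi_sdiff (hd : Odd d) {c : C.Cell} (hc : C.dim c = d) (E : C.Config) :
    C.chi (E ∩ C.bdry c) + C.chi (C.bdry c \ E) = 2 := by
  rw [← chi_union, C.sum_closureCells_inter hd hc, add_zero, ← C.chi_bdry hd hc]
  congr 1
  ext f
  simp only [Finset.mem_union, Finset.mem_inter, Finset.mem_sdiff]
  tauto

/-- Where two of the three walls that a closed configuration `E` and the boundary of a `d`-cell `c`
make up meet, the third one is also present. -/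
theorem IsClosedConfig.closureCells_inter {C : GenericCellulation d X} {E : C.Config}
    (hE : C.IsClosedConfig E) {c : C.Cell} (hc : C.dim c = d) :
    C.closureCells (E \ C.bdry c) ∩ C.closureCells (E ∩ C.bdry c) =
        C.closureCells (E ∩ C.bdry c) ∩ C.closureCells (C.bdry c \ E) ∧
    C.closureCells (E \ C.bdry c) ∩ C.closureCells (C.bdry c \ E) =
        C.closureCells (E ∩ C.bdry c) ∩ C.closureCells (C.bdry c \ E) := by
  have key : ∀ b ≤ c,
      (b ∈ C.closureCells (E \ C.bdry c) ∧
        (b ∈ C.closureCells (E ∩ C.bdry c) ∨ b ∈ C.closureCells (C.bdry c \ E))) ∨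
      (b ∈ C.closureCells (E ∩ C.bdry c) ∧ b ∈ C.closureCells (C.bdry c \ E)) →
      b ∈ C.closureCells (E \ C.bdry c) ∧ b ∈ C.closureCells (E ∩ C.bdry c) ∧
        b ∈ C.closureCells (C.bdry c \ E) := by
    intro b hbc
    obtain ⟨M⟩ := C.nonempty_localModel b
    obtain ⟨v, rfl⟩ := M.exists_up_singleton c hc hbc
    have hA : b ∈ C.closureCells (E ∩ C.bdry (M.up {v})) ↔ ∃ x, ∃ h : v ≠ x, M.qubit v x h ∈ E := by
      rw [mem_closureCells]
      constructor
      · rintro ⟨f, hf, hbf⟩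
        obtain ⟨hf, hfc⟩ := Finset.mem_inter.1 hf
        obtain ⟨x, hx, rfl⟩ := M.exists_qubit_of_le f hbf (C.mem_bdry.1 hfc)
        exact ⟨x, hx, hf⟩
      · rintro ⟨x, hx, h⟩
        exact ⟨_, Finset.mem_inter.2 ⟨h, C.mem_bdry.2 ((M.qubit_le_iff _ _ _ _).2 (Or.inl rfl))⟩,
          M.le_qubit _ _ _⟩
    have hC : b ∈ C.closureCells (C.bdry (M.up {v}) \ E) ↔ ∃ x, ∃ h : v ≠ x, M.qubit v x h ∉ E := by
      rw [mem_closureCells]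
      constructor
      · rintro ⟨f, hf, hbf⟩
        obtain ⟨hfc, hf⟩ := Finset.mem_sdiff.1 hf
        obtain ⟨x, hx, rfl⟩ := M.exists_qubit_of_le f hbf (C.mem_bdry.1 hfc)
        exact ⟨x, hx, hf⟩
      · rintro ⟨x, hx, h⟩
        exact ⟨_, Finset.mem_sdiff.2 ⟨C.mem_bdry.2 ((M.qubit_le_iff _ _ _ _).2 (Or.inl rfl)), h⟩,
          M.le_qubit _ _ _⟩
    have hB : b ∈ C.closureCells (E \ C.bdry (M.up {v})) ↔
        ∃ x y, ∃ h : x ≠ y, v ≠ x ∧ v ≠ y ∧ M.qubit x y h ∈ E := by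
      rw [mem_closureCells]
      constructor
      · rintro ⟨f, hf, hbf⟩
        obtain ⟨hf, hfc⟩ := Finset.mem_sdiff.1 hf
        obtain ⟨x, y, h, rfl⟩ := M.exists_qubit f hbf
        rw [C.mem_bdry, M.qubit_le_iff, not_or] at hfc
        exact ⟨x, y, h, hfc.1, hfc.2, hf⟩
      · rintro ⟨x, y, h, hx, hy, hf⟩
        refine ⟨_, Finset.mem_sdiff.2 ⟨hf, ?_⟩, M.le_qubit _ _ _⟩
        rw [C.mem_bdry, M.qubit_le_iff, not_or]
        exact ⟨hx, hy⟩
    rw [hA, hB, hC]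
    -- In the triangle `v, x, y`, a present edge `xy` forces exactly one of `vx`, `vy` to be
    -- present; conversely `vx` present and `vy` absent force `xy`.
    rintro (⟨⟨x, y, h, hx, hy, hf⟩, -⟩ | ⟨⟨x, hx, hxE⟩, y, hy, hyE⟩)
    · have ht := hE.triple M hx hy h
      refine ⟨⟨x, y, h, hx, hy, hf⟩, ?_⟩
      by_cases h1 : M.qubit v x hx ∈ E
      · simp only [h1, hf, true_iff, iff_true] at ht
        exact ⟨⟨x, hx, h1⟩, y, hy, ht⟩
      · simp only [h1, hf, false_iff, iff_true, not_not] at ht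
        exact ⟨⟨y, hy, ht⟩, x, hx, h1⟩
    · have hxy : x ≠ y := by rintro rfl; exact hyE hxE
      have ht := hE.triple M hx hy hxy
      simp only [hxE, hyE, false_iff, true_iff, not_not] at ht
      exact ⟨⟨x, y, hxy, hx, hy, ht⟩, ⟨x, hx, hxE⟩, y, hy, hyE⟩
  have hle : ∀ b, b ∈ C.closureCells (E ∩ C.bdry c) ∨ b ∈ C.closureCells (C.bdry c \ E) → b ≤ c := by
    simp only [mem_closureCells, Finset.mem_inter, Finset.mem_sdiff, mem_bdry]
    rintro b (⟨f, hf, hb⟩ | ⟨f, hf, hb⟩)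
    · exact hb.trans hf.2
    · exact hb.trans hf.1
  constructor
  · ext b
    rw [Finset.mem_inter, Finset.mem_inter]
    refine ⟨fun h => (key b (hle b (Or.inl h.2)) (Or.inl ⟨h.1, Or.inl h.2⟩)).2, fun h => ?_⟩
    have k := key b (hle b (Or.inl h.1)) (Or.inr h)
    exact ⟨k.1, k.2.1⟩
  · ext b
    rw [Finset.mem_inter, Finset.mem_inter]
    refine ⟨fun h => (key b (hle b (Or.inr h.2)) (Or.inl ⟨h.1, Or.inr h.2⟩)).2, fun h => ?_⟩
    have k := key b (hle b (Or.inl h.1)) (Or.inr h)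
    exact ⟨k.1, k.2.2⟩

/-- The change of the Euler characteristic of a closed configuration under the flip of the
boundary of a `d`-cell. -/
theorem IsClosedConfig.chi_symmDiff {C : GenericCellulation d X} (hd : Odd d) {E : C.Config}
    (hE : C.IsClosedConfig E) {c : C.Cell} (hc : C.dim c = d) :
    C.chi (symmDiff E (C.bdry c)) = C.chi E + 2 - 2 * C.chi (E ∩ C.bdry c) := by
  obtain ⟨h1, h2⟩ := hE.closureCells_inter hc
  have h3 := C.chi_union (E \ C.bdry c) (E ∩ C.bdry c)
  have h4 := C.chi_union (E \ C.bdry c) (C.bdry c \ E)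
  rw [h1, C.sum_closureCells_inter hd hc, Finset.sdiff_union_inter] at h3
  rw [h2, C.sum_closureCells_inter hd hc] at h4
  have h5 := C.chi_inter_add_chi_sdiff hd hc E
  rw [symmDiff, Finset.sup_eq_union]
  linarith

/-! ### Flips preserve closed configurations -/

theorem even_card_symmDiff {α : Type*} [DecidableEq α] (A B : Finset α) :
    Even (symmDiff A B).card ↔ (Even A.card ↔ Even B.card) := by
  have h1 := Finset.card_sdiff_add_card_inter A B
  have h2 := Finset.card_sdiff_add_card_inter B A
  have h3 : (symmDiff A B).card = (A \ B).card + (B \ A).card := by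
    rw [symmDiff, Finset.sup_eq_union, Finset.card_union_of_disjoint disjoint_sdiff_sdiff]
  rw [Finset.inter_comm] at h2
  rw [← h1, ← h2, h3]
  simp only [Nat.even_add]
  tauto

/-- A `(d-2)`-face of `c` is dual to a triangle having `c` as a vertex, and exactly two edges meet
there; at other `(d-2)`-cells no wall of `c` occurs. -/
theorem isClosedConfig_bdry {c : C.Cell} (hc : C.dim c = d) : C.IsClosedConfig (C.bdry c) := by
  intro e he
  by_cases hec : e ≤ c
  · obtain ⟨M⟩ := C.nonempty_localModel e
    obtain ⟨v, rfl⟩ := M.exists_up_singleton c hc hec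
    have hcard : (Finset.univ.erase v).card = 2 := by
      rw [Finset.card_erase_of_mem (Finset.mem_univ _), Finset.card_univ, Fintype.card_fin]
      lia
    obtain ⟨x, y, hxy, h⟩ := Finset.card_eq_two.1 hcard
    have hx : v ≠ x := by rintro rfl; simpa using h.ge (Finset.mem_insert_self _ _)
    have hy : v ≠ y := by rintro rfl; simpa using h.ge (Finset.mem_insert_of_mem (Finset.mem_singleton_self _))
    have : C.bdry (M.up {v}) ∩ C.cobdry e = {M.qubit v x hx, M.qubit v y hy} := by
      ext f
      simp only [Finset.mem_inter, mem_bdry, mem_cobdry, Finset.mem_insert, Finset.mem_singleton]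
      constructor
      · rintro ⟨h1, h2⟩
        obtain ⟨z, hz, rfl⟩ := M.exists_qubit_of_le f h2 h1
        have : z ∈ Finset.univ.erase v := by simp [hz.symm]
        rw [h] at this
        rcases Finset.mem_insert.1 this with rfl | h3
        · exact Or.inl rfl
        · obtain rfl := Finset.mem_singleton.1 h3
          exact Or.inr rfl
      · rintro (rfl | rfl) <;>
          exact ⟨(M.qubit_le_iff _ _ _ _).2 (Or.inl rfl), M.le_qubit _ _ _⟩
    rw [this, Finset.card_pair (M.qubit_ne hx hy hxy)]
    exact even_two
  · have : C.bdry c ∩ C.cobdry e = ∅ := by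
      ext f
      simp only [Finset.mem_inter, mem_bdry, mem_cobdry, Finset.notMem_empty, iff_false]
      exact fun h => hec (h.2.trans h.1)
    rw [this]
    simp

theorem isClosedConfig_symmDiff_bdry_iff {c : C.Cell} (hc : C.dim c = d) (E : C.Config) :
    C.IsClosedConfig (symmDiff E (C.bdry c)) ↔ C.IsClosedConfig E := by
  refine forall₂_congr fun e he => ?_
  have h1 : symmDiff E (C.bdry c) ∩ C.cobdry e =
      symmDiff (E ∩ C.cobdry e) (C.bdry c ∩ C.cobdry e) := by
    ext f
    simp only [Finset.mem_symmDiff, Finset.mem_inter]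
    tauto
  rw [h1, even_card_symmDiff]
  have := C.isClosedConfig_bdry hc e he
  tauto

end GenericCellulation

open scoped ComplexOrder

/-! ### Ground spaces of positive semidefinite Hamiltonians -/

section PosSemidef

variable {n : Type*} [Fintype n]

/-- Two nonnegative expectation values with sum zero both vanish, and for a positive semidefinite
matrix this already puts the state in the kernel. -/
theorem _root_.Matrix.PosSemidef.add_mulVec_eq_zero_iff {A B : Matrix n n ℂ} (hA : A.PosSemidef)
    (hB : B.PosSemidef) (ψ : n → ℂ) :
    (A + B).mulVec ψ = 0 ↔ A.mulVec ψ = 0 ∧ B.mulVec ψ = 0 := by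
  rw [← hA.dotProduct_mulVec_zero_iff, ← hB.dotProduct_mulVec_zero_iff,
    ← (hA.add hB).dotProduct_mulVec_zero_iff, Matrix.add_mulVec, dotProduct_add]
  exact add_eq_zero_iff_of_nonneg (hA.dotProduct_mulVec_nonneg ψ) (hB.dotProduct_mulVec_nonneg ψ)

variable [DecidableEq n]

theorem _root_.Matrix.PosSemidef.energy_nonneg {H : Matrix n n ℂ} (hH : H.PosSemidef) {x : ℝ}
    (hx : x ∈ energies H) : 0 ≤ x := by
  obtain ⟨ψ, hψ⟩ := Module.End.HasEigenvalue.exists_hasEigenvector hx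
  have h1 : H.mulVec ψ = (x : ℂ) • ψ := by
    simpa using Module.End.mem_eigenspace_iff.1 hψ.1
  have h2 := hH.dotProduct_mulVec_nonneg ψ
  rw [h1, dotProduct_smul, smul_eq_mul] at h2
  have h3 : 0 < star ψ ⬝ᵥ ψ := Matrix.dotProduct_star_self_pos_iff.2 hψ.2
  have h4 : (0 : ℂ) ≤ x := by
    by_contra h
    have hneg : (x : ℂ) < 0 := by
      rw [← Complex.ofReal_zero, Complex.real_lt_real]
      by_contra h'
      exact h (by rw [← Complex.ofReal_zero, Complex.real_le_real]; exact not_lt.1 h')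
    exact absurd h2 (not_le_of_gt (mul_neg_of_neg_of_pos hneg h3))
  exact_mod_cast h4

theorem _root_.Matrix.PosSemidef.isLeast_energies {H : Matrix n n ℂ} (hH : H.PosSemidef)
    {ψ : n → ℂ} (hψ : ψ ≠ 0) (h : H.mulVec ψ = 0) : IsLeast (energies H) 0 := by
  refine ⟨?_, fun x hx => hH.energy_nonneg hx⟩
  refine Module.End.hasEigenvalue_of_hasEigenvector (x := ψ) ⟨?_, hψ⟩
  rw [Module.End.mem_eigenspace_iff]
  simp [h]

theorem mem_groundSpace_iff {H : Matrix n n ℂ} (hH : IsLeast (energies H) 0) (ψ : n → ℂ) :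
    ψ ∈ groundSpace H ↔ H.mulVec ψ = 0 := by
  rw [groundSpace, hH.csInf_eq, Module.End.mem_eigenspace_iff]
  simp

theorem posSemidef_half_one_sub {O : Matrix n n ℂ} (h : O.IsHermitian) (h2 : O * O = 1) :
    ((1 / 2 : ℂ) • (1 - O)).PosSemidef := by
  have e : (1 / 2 : ℂ) • (1 - O) = ((1 / 2 : ℂ) • (1 - O)).conjTranspose * ((1 / 2 : ℂ) • (1 - O)) := by
    rw [Matrix.conjTranspose_smul, Matrix.conjTranspose_sub, Matrix.conjTranspose_one, h.eq,
      Matrix.smul_mul, Matrix.mul_smul, smul_smul]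
    have : (1 - O) * (1 - O) = (2 : ℂ) • (1 - O) := by
      rw [sub_mul, one_mul, mul_sub, mul_one, h2, two_smul]; abel
    rw [this, smul_smul]
    congr 1
    simp
  rw [e]
  exact Matrix.posSemidef_conjTranspose_mul_self _

end PosSemidef

/-! ### Flip operators -/

section flip

variable {Q : Type*} [DecidableEq Q]

/-- The operator that flips the qubits in `D`, with a sign that depends on the configuration. -/
noncomputable def flipOp (D : Finset Q) (σ : Finset Q → ℂ) : Matrix (Finset Q) (Finset Q) ℂ :=
  Matrix.of fun F E => if F = symmDiff E D then σ E else 0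

theorem eq_symmDiff_iff {D F E : Finset Q} : F = symmDiff E D ↔ E = symmDiff F D := by
  constructor <;> rintro rfl <;> rw [symmDiff_symmDiff_cancel_right]

theorem flipOp_mulVec [Fintype Q] (D : Finset Q) (σ : Finset Q → ℂ) (ψ : Finset Q → ℂ) (F : Finset Q) :
    (flipOp D σ).mulVec ψ F = σ (symmDiff F D) * ψ (symmDiff F D) := by
  simp only [Matrix.mulVec, dotProduct, flipOp, Matrix.of_apply, eq_symmDiff_iff (F := F)]
  simp

/-- Invariance of the real sign under the flip makes the operator self-adjoint, and values `±1` make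
it an involution; half of `1 - O` is then a projection. -/
theorem posSemidef_flipOp [Fintype Q] (D : Finset Q) (σ : Finset Q → ℂ) (h1 : ∀ E, σ E = 1 ∨ σ E = -1)
    (h2 : ∀ E, σ (symmDiff E D) = σ E) : ((1 / 2 : ℂ) • (1 - flipOp D σ)).PosSemidef := by
  refine posSemidef_half_one_sub ?_ ?_
  · ext F E
    simp only [Matrix.conjTranspose_apply, flipOp, Matrix.of_apply]
    by_cases h : F = symmDiff E D
    · rw [if_pos h, if_pos (eq_symmDiff_iff.1 h), h, h2]
      rcases h1 E with h | h <;> simp [h]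
    · rw [if_neg h, if_neg fun h' => h (eq_symmDiff_iff.1 h'), star_zero]
  · refine Matrix.toLin'.injective (LinearMap.ext fun ψ => funext fun F => ?_)
    rw [Matrix.toLin'_apply, ← Matrix.mulVec_mulVec, flipOp_mulVec, flipOp_mulVec,
      symmDiff_symmDiff_cancel_right, h2, ← mul_assoc]
    rcases h1 F with h | h <;> simp [h]

end flip

namespace GenericCellulation

variable {d : ℕ} {X : Type*} [TopologicalSpace X] (C : GenericCellulation d X)

/-! ### The Hamiltonians -/

theorem prodX_eq (c : C.Cell) : C.prodX c = flipOp (C.bdry c) fun _ => 1 := rfl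

theorem semionO_eq (c : C.Cell) :
    C.semionO c = flipOp (C.bdry c) fun E => -(-1 : ℂ) ^ C.chi (E ∩ C.bdry c) := by
  ext F E
  rw [semionO, Matrix.mul_diagonal]
  simp only [prodX, flipOp, Matrix.of_apply, ite_mul, one_mul, zero_mul]

/-- Seen as a flip of no qubits, the diagonal term falls under the same positivity lemma as the
others. -/
theorem prodZ_eq (e : C.Cell) :
    C.prodZ e = flipOp ∅ fun E => (-1) ^ (E ∩ C.cobdry e).card := by
  ext F E
  simp only [prodZ, Matrix.diagonal_apply, flipOp, Matrix.of_apply, ← Finset.bot_eq_empty,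
    symmDiff_bot]
  by_cases h : F = E <;> simp [h]

theorem posSemidef_hPlus : C.hPlus.PosSemidef := by
  refine Matrix.posSemidef_sum _ fun e _ => ?_
  rw [prodZ_eq]
  refine posSemidef_flipOp _ _ (fun E => neg_one_pow_eq_or _ _) fun E => ?_
  rw [← Finset.bot_eq_empty, symmDiff_bot]

theorem posSemidef_hSquareGTC : C.hSquareGTC.PosSemidef :=
  Matrix.posSemidef_sum _ fun _ _ => posSemidef_flipOp _ _ (fun _ => Or.inl rfl) fun _ => rfl

theorem neg_one_zpow_eq_or (m : ℤ) : (-1 : ℂ) ^ m = 1 ∨ (-1 : ℂ) ^ m = -1 := by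
  rcases Int.even_or_odd m with h | h
  · exact Or.inl h.neg_one_zpow
  · exact Or.inr h.neg_one_zpow

theorem posSemidef_hSquareGDS (hd : Odd d) : C.hSquareGDS.PosSemidef := by
  refine Matrix.posSemidef_sum _ fun c hc => ?_
  rw [semionO_eq]
  refine posSemidef_flipOp _ _ (fun E => ?_) fun E => ?_
  · rcases neg_one_zpow_eq_or (C.chi (E ∩ C.bdry c)) with h | h <;> simp [h]
  · have h := C.chi_inter_add_chi_sdiff hd (Finset.mem_filter.1 hc).2 E
    have e : symmDiff E (C.bdry c) ∩ C.bdry c = C.bdry c \ E := by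
      ext f; simp only [Finset.mem_symmDiff, Finset.mem_inter, Finset.mem_sdiff]; tauto
    -- The flip replaces the present walls of `c` by the absent ones; the two Euler characteristics
    -- sum to `2`, so they have equal parity.
    rw [e, show C.chi (C.bdry c \ E) = C.chi (E ∩ C.bdry c) + 2 * (1 - C.chi (E ∩ C.bdry c)) by
      linarith, zpow_add₀ (by norm_num), zpow_mul]
    simp

/-- `H_+` is diagonal, and its entry at `E` is the number of `(d-2)`-cells where evenness fails. -/
theorem hPlus_mulVec_eq_zero_iff (ψ : C.Config → ℂ) :
    C.hPlus.mulVec ψ = 0 ↔ ∀ E, ¬ C.IsClosedConfig E → ψ E = 0 := by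
  classical
  have h : ∀ E, C.hPlus.mulVec ψ E = (((Finset.univ.filter fun e : C.Cell =>
      C.dim e + 2 = d ∧ ¬ Even (E ∩ C.cobdry e).card).card : ℕ) : ℂ) * ψ E := by
    intro E
    have h1 : ∀ e, ((1 / 2 : ℂ) • (1 - C.prodZ e)).mulVec ψ E =
        (if ¬ Even (E ∩ C.cobdry e).card then 1 else 0) * ψ E := by
      intro e
      rw [Matrix.smul_mulVec, Matrix.sub_mulVec, Matrix.one_mulVec, prodZ, Pi.smul_apply,
        Pi.sub_apply, Matrix.mulVec_diagonal]
      split_ifs with h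
      · rw [h.neg_one_pow, smul_eq_mul]; ring
      · rw [(Nat.not_even_iff_odd.1 h).neg_one_pow, smul_eq_mul]; ring
    rw [hPlus, Matrix.sum_mulVec, Finset.sum_apply, Finset.sum_congr rfl fun e _ => h1 e,
      ← Finset.sum_mul, Finset.sum_boole, Finset.filter_filter]
  constructor
  · intro h0 E hE
    have h1 := h E
    rw [h0, Pi.zero_apply, eq_comm, mul_eq_zero] at h1
    refine h1.resolve_left ?_
    rw [IsClosedConfig] at hE
    push Not at hE
    obtain ⟨e, he, he'⟩ := hE
    rw [Nat.cast_eq_zero, ← ne_eq, ← Nat.pos_iff_ne_zero, Finset.card_pos]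
    exact ⟨e, Finset.mem_filter.2 ⟨Finset.mem_univ _, he, he'⟩⟩
  · intro h0
    funext E
    rw [h E, Pi.zero_apply, mul_eq_zero]
    by_cases hE : C.IsClosedConfig E
    · left
      rw [Nat.cast_eq_zero, Finset.card_eq_zero, Finset.filter_eq_empty_iff]
      exact fun e _ he => he.2 (hE e he.1)
    · exact Or.inr (h0 E hE)

theorem hSquareGTC_mulVec (ψ : C.Config → ℂ) (F : C.Config) :
    C.hSquareGTC.mulVec ψ F = ∑ c : C.Cell with C.dim c = d,
      (1 / 2 : ℂ) * (ψ F - ψ (symmDiff F (C.bdry c))) := by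
  rw [hSquareGTC, Matrix.sum_mulVec, Finset.sum_apply]
  refine Finset.sum_congr (by congr!) fun c _ => ?_
  rw [Matrix.smul_mulVec, Matrix.sub_mulVec, Matrix.one_mulVec, prodX_eq, Pi.smul_apply,
    Pi.sub_apply, flipOp_mulVec, smul_eq_mul, one_mul]

theorem hSquareGDS_mulVec (ψ : C.Config → ℂ) (F : C.Config) :
    C.hSquareGDS.mulVec ψ F = ∑ c : C.Cell with C.dim c = d,
      (1 / 2 : ℂ) * (ψ F - -(-1 : ℂ) ^ C.chi (symmDiff F (C.bdry c) ∩ C.bdry c) *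
        ψ (symmDiff F (C.bdry c))) := by
  rw [hSquareGDS, Matrix.sum_mulVec, Finset.sum_apply]
  refine Finset.sum_congr (by congr!) fun c _ => ?_
  rw [Matrix.smul_mulVec, Matrix.sub_mulVec, Matrix.one_mulVec, semionO_eq, Pi.smul_apply,
    Pi.sub_apply, flipOp_mulVec, smul_eq_mul]

theorem phaseU_mulVec (ψ : C.Config → ℂ) (F : C.Config) :
    C.phaseU.mulVec ψ F = Complex.I ^ C.chi F * ψ F := Matrix.mulVec_diagonal _ _ _

theorem phaseU_mem_unitaryGroup : C.phaseU ∈ Matrix.unitaryGroup C.Config ℂ := by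
  rw [Matrix.mem_unitaryGroup_iff, phaseU, Matrix.star_eq_conjTranspose,
    Matrix.diagonal_conjTranspose, Matrix.diagonal_mul_diagonal, ← Matrix.diagonal_one]
  congr 1
  funext E
  rw [Pi.star_apply, star_zpow₀, ← mul_zpow]
  simp

theorem phaseU_inv : C.phaseU⁻¹ = Matrix.diagonal fun E => Complex.I ^ (-C.chi E) := by
  refine Matrix.inv_eq_right_inv ?_
  rw [phaseU, Matrix.diagonal_mul_diagonal, ← Matrix.diagonal_one]
  congr 1
  funext E
  rw [← zpow_add₀ Complex.I_ne_zero, add_neg_cancel, zpow_zero]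

theorem phaseU_mul_inv : C.phaseU * C.phaseU⁻¹ = 1 := by
  rw [phaseU_inv, phaseU, Matrix.diagonal_mul_diagonal, ← Matrix.diagonal_one]
  congr 1
  funext E
  rw [← zpow_add₀ Complex.I_ne_zero, add_neg_cancel, zpow_zero]

theorem phaseU_inv_mulVec (ψ : C.Config → ℂ) (F : C.Config) :
    C.phaseU⁻¹.mulVec ψ F = Complex.I ^ (-C.chi F) * ψ F := by
  rw [phaseU_inv]; exact Matrix.mulVec_diagonal _ _ _

/-- On closed configurations, `U` intertwines the two theories. -/
theorem phaseU_mulVec_hSquareGDS (hd : Odd d) {ψ : C.Config → ℂ} (hψ : C.hPlus.mulVec ψ = 0) :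
    C.phaseU.mulVec (C.hSquareGDS.mulVec ψ) = C.hSquareGTC.mulVec (C.phaseU.mulVec ψ) := by
  rw [hPlus_mulVec_eq_zero_iff] at hψ
  funext F
  rw [phaseU_mulVec, hSquareGDS_mulVec, hSquareGTC_mulVec, Finset.mul_sum]
  refine Finset.sum_congr rfl fun c hc => ?_
  have hc := (Finset.mem_filter.1 hc).2
  rw [phaseU_mulVec, phaseU_mulVec]
  set E := symmDiff F (C.bdry c) with hE
  have hF : F = symmDiff E (C.bdry c) := by rw [hE, symmDiff_symmDiff_cancel_right]
  by_cases hcl : C.IsClosedConfig E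
  -- Here `E` is the configuration before the flip and `F` the one after; the flip formula makes the
  -- total exponent of `i` equal to `χ(E) + 2`.
  · have h1 : Complex.I ^ C.chi F * (-1) ^ C.chi (E ∩ C.bdry c) = -Complex.I ^ C.chi E := by
      conv_lhs => rw [hF, hcl.chi_symmDiff hd hc]
      rw [← Complex.I_sq, ← zpow_natCast, ← zpow_mul, ← zpow_add₀ Complex.I_ne_zero]
      rw [show C.chi E + 2 - 2 * C.chi (E ∩ C.bdry c) + ((2 : ℕ) : ℤ) * C.chi (E ∩ C.bdry c) =
        C.chi E + 2 by push_cast; ring, zpow_add₀ Complex.I_ne_zero]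
      simp [zpow_ofNat]
    linear_combination (1 / 2 : ℂ) * ψ E * h1
  · rw [hψ E hcl]; ring

theorem hPlus_mulVec_phaseU {ψ : C.Config → ℂ} (hψ : C.hPlus.mulVec ψ = 0) :
    C.hPlus.mulVec (C.phaseU.mulVec ψ) = 0 := by
  rw [hPlus_mulVec_eq_zero_iff] at hψ ⊢
  intro E hE
  rw [phaseU_mulVec, hψ E hE, mul_zero]

theorem hPlus_mulVec_phaseU_inv {ψ : C.Config → ℂ} (hψ : C.hPlus.mulVec ψ = 0) :
    C.hPlus.mulVec (C.phaseU⁻¹.mulVec ψ) = 0 := by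
  rw [hPlus_mulVec_eq_zero_iff] at hψ ⊢
  intro E hE
  rw [phaseU_inv_mulVec, hψ E hE, mul_zero]

theorem hPlus_mulVec_hSquareGDS {ψ : C.Config → ℂ} (hψ : C.hPlus.mulVec ψ = 0) :
    C.hPlus.mulVec (C.hSquareGDS.mulVec ψ) = 0 := by
  rw [hPlus_mulVec_eq_zero_iff] at hψ ⊢
  intro E hE
  rw [hSquareGDS_mulVec]
  refine Finset.sum_eq_zero fun c hc => ?_
  rw [hψ E hE, hψ _ (mt (C.isClosedConfig_symmDiff_bdry_iff (Finset.mem_filter.1 hc).2 E).1 hE)]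
  ring

theorem hPlus_mulVec_hSquareGTC {ψ : C.Config → ℂ} (hψ : C.hPlus.mulVec ψ = 0) :
    C.hPlus.mulVec (C.hSquareGTC.mulVec ψ) = 0 := by
  rw [hPlus_mulVec_eq_zero_iff] at hψ ⊢
  intro E hE
  rw [hSquareGTC_mulVec]
  refine Finset.sum_eq_zero fun c hc => ?_
  rw [hψ E hE, hψ _ (mt (C.isClosedConfig_symmDiff_bdry_iff (Finset.mem_filter.1 hc).2 E).1 hE)]
  ring

/-! ### Ground states and their transport by `U` -/

/-- The toric code has a ground state: the equal superposition of the closed configurations. -/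
theorem exists_toricCode_groundState :
    ∃ φ : C.Config → ℂ, φ ≠ 0 ∧ C.hPlus.mulVec φ = 0 ∧ C.hSquareGTC.mulVec φ = 0 := by
  classical
  refine ⟨fun E => if C.IsClosedConfig E then 1 else 0, fun h => ?_, ?_, ?_⟩
  · have h1 : C.IsClosedConfig ∅ := fun e _ => by simp
    have := congrFun h ∅
    simp [h1] at this
  · rw [hPlus_mulVec_eq_zero_iff]
    exact fun E hE => if_neg hE
  · funext F
    rw [hSquareGTC_mulVec]
    refine Finset.sum_eq_zero fun c hc => ?_
    simp only [C.isClosedConfig_symmDiff_bdry_iff (Finset.mem_filter.1 hc).2 F, sub_self, mul_zero]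

theorem phaseU_mulVec_inv (ψ : C.Config → ℂ) : C.phaseU.mulVec (C.phaseU⁻¹.mulVec ψ) = ψ := by
  rw [Matrix.mulVec_mulVec, phaseU_mul_inv, Matrix.one_mulVec]

theorem phaseU_mulVec_eq_zero {ψ : C.Config → ℂ} (h : C.phaseU.mulVec ψ = 0) : ψ = 0 := by
  funext F
  have := congrFun h F
  rw [phaseU_mulVec] at this
  exact (mul_eq_zero.1 this).resolve_left (zpow_ne_zero _ Complex.I_ne_zero)

theorem hSquareGDS_mulVec_phaseU_inv (hd : Odd d) {φ : C.Config → ℂ} (h1 : C.hPlus.mulVec φ = 0)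
    (h2 : C.hSquareGTC.mulVec φ = 0) : C.hSquareGDS.mulVec (C.phaseU⁻¹.mulVec φ) = 0 := by
  refine C.phaseU_mulVec_eq_zero ?_
  rw [C.phaseU_mulVec_hSquareGDS hd (C.hPlus_mulVec_phaseU_inv h1), phaseU_mulVec_inv, h2]

theorem isLeast_energies_hPlus : IsLeast (energies C.hPlus) 0 := by
  obtain ⟨φ, h0, h1, -⟩ := C.exists_toricCode_groundState
  exact C.posSemidef_hPlus.isLeast_energies h0 h1

theorem isLeast_energies_hGTC : IsLeast (energies C.hGTC) 0 := by
  obtain ⟨φ, h0, h1, h2⟩ := C.exists_toricCode_groundState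
  refine (C.posSemidef_hPlus.add C.posSemidef_hSquareGTC).isLeast_energies h0 ?_
  rw [Matrix.add_mulVec, h1, h2, add_zero]

theorem isLeast_energies_hGDS (hd : Odd d) : IsLeast (energies C.hGDS) 0 := by
  obtain ⟨φ, h0, h1, h2⟩ := C.exists_toricCode_groundState
  refine (C.posSemidef_hPlus.add (C.posSemidef_hSquareGDS hd)).isLeast_energies
    (ψ := C.phaseU⁻¹.mulVec φ) (fun h => h0 ?_) ?_
  · rw [← C.phaseU_mulVec_inv φ, h, Matrix.mulVec_zero]
  · rw [Matrix.add_mulVec, C.hPlus_mulVec_phaseU_inv h1, C.hSquareGDS_mulVec_phaseU_inv hd h1 h2,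
      add_zero]

theorem map_phaseU_groundSpace (hd : Odd d) :
    Submodule.map (Matrix.toLin' C.phaseU) (groundSpace C.hGDS) = groundSpace C.hGTC := by
  ext φ
  rw [mem_groundSpace_iff C.isLeast_energies_hGTC, hGTC,
    C.posSemidef_hPlus.add_mulVec_eq_zero_iff C.posSemidef_hSquareGTC, Submodule.mem_map]
  have key : ∀ ψ, ψ ∈ groundSpace C.hGDS ↔ C.hPlus.mulVec ψ = 0 ∧ C.hSquareGDS.mulVec ψ = 0 := by
    intro ψ
    rw [mem_groundSpace_iff (C.isLeast_energies_hGDS hd), hGDS,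
      C.posSemidef_hPlus.add_mulVec_eq_zero_iff (C.posSemidef_hSquareGDS hd)]
  constructor
  · rintro ⟨ψ, hψ, rfl⟩
    obtain ⟨h1, h2⟩ := (key ψ).1 hψ
    rw [Matrix.toLin'_apply]
    exact ⟨C.hPlus_mulVec_phaseU h1, by
      rw [← C.phaseU_mulVec_hSquareGDS hd h1, h2, Matrix.mulVec_zero]⟩
  · rintro ⟨h1, h2⟩
    exact ⟨_, (key _).2 ⟨C.hPlus_mulVec_phaseU_inv h1, C.hSquareGDS_mulVec_phaseU_inv hd h1 h2⟩,
      C.phaseU_mulVec_inv φ⟩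

theorem phaseU_conj_hSquareGDS (hd : Odd d) {ψ : C.Config → ℂ} (hψ : C.hPlus.mulVec ψ = 0) :
    (C.phaseU * C.hSquareGDS * C.phaseU⁻¹).mulVec ψ = C.hSquareGTC.mulVec ψ := by
  rw [← Matrix.mulVec_mulVec, ← Matrix.mulVec_mulVec,
    C.phaseU_mulVec_hSquareGDS hd (C.hPlus_mulVec_phaseU_inv hψ), phaseU_mulVec_inv]

end GenericCellulation

/-! ### Colourings and phase gates -/

/-- Greedy colouring. -/
theorem exists_coloring {V : Type*} [Fintype V] [DecidableEq V] (r : V → V → Prop)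
    [DecidableRel r] (hr : ∀ v w, r v w → r w v) (N : ℕ)
    (hN : ∀ v, (Finset.univ.filter fun w => r v w).card < N) :
    ∃ color : V → Fin N, ∀ v w, v ≠ w → r v w → color v ≠ color w := by
  suffices h : ∀ S : Finset V, ∃ color : V → Fin N,
      ∀ v ∈ S, ∀ w ∈ S, v ≠ w → r v w → color v ≠ color w by
    obtain ⟨color, hc⟩ := h Finset.univ
    exact ⟨color, fun v w => hc v (Finset.mem_univ _) w (Finset.mem_univ _)⟩
  intro S
  induction S using Finset.induction_on with
  | empty => exact ⟨fun v => ⟨0, (Nat.zero_le _).trans_lt (hN v)⟩, by simp⟩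
  | insert v S hv ih =>
    obtain ⟨color, hc⟩ := ih
    obtain ⟨i, -, hi⟩ : ∃ i ∈ (Finset.univ : Finset (Fin N)),
        i ∉ (Finset.univ.filter fun w => r v w).image color := by
      refine Finset.exists_mem_notMem_of_card_lt_card ?_
      rw [Finset.card_univ, Fintype.card_fin]
      exact Finset.card_image_le.trans_lt (hN v)
    have hi' : ∀ w, r v w → color w ≠ i := fun w hw e =>
      hi (Finset.mem_image.2 ⟨w, Finset.mem_filter.2 ⟨Finset.mem_univ _, hw⟩, e⟩)
    refine ⟨Function.update color v i, fun x hx y hy hxy hxr => ?_⟩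
    rcases eq_or_ne x v with rfl | hxv
    · rw [Function.update_self, Function.update_of_ne hxy.symm]
      exact (hi' y hxr).symm
    · rw [Function.update_of_ne hxv]
      rcases eq_or_ne y v with rfl | hyv
      · rw [Function.update_self]
        exact hi' x (hr _ _ hxr)
      · rw [Function.update_of_ne hyv]
        exact hc x (Finset.mem_of_mem_insert_of_ne hx hxv) y
          (Finset.mem_of_mem_insert_of_ne hy hyv) hxy hxr

/-- The gate that applies a phase `z` to the configurations that meet `S`. -/
noncomputable def phaseGate {Q : Type*} [Fintype Q] [DecidableEq Q] (S : Finset Q) (z : ℂ)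
    (hz : z * star z = 1) : Gate Q where
  support := S
  op := Matrix.diagonal fun E => if (E ∩ S).Nonempty then z else 1
  unitary := by
    rw [Matrix.mem_unitaryGroup_iff, Matrix.star_eq_conjTranspose,
      Matrix.diagonal_conjTranspose, Matrix.diagonal_mul_diagonal, ← Matrix.diagonal_one]
    congr 1
    funext E
    rw [Pi.star_apply]
    split_ifs
    · exact hz
    · simp
  supported := by
    refine ⟨fun F E => if F = E then (if E.Nonempty then z else 1) else 0, fun F E => ?_⟩
    have h : F = E ↔ F \ S = E \ S ∧ F ∩ S = E ∩ S := by
      constructor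
      · rintro rfl; exact ⟨rfl, rfl⟩
      · rintro ⟨h1, h2⟩
        rw [← Finset.sdiff_union_inter F S, h1, h2, Finset.sdiff_union_inter]
    rw [Matrix.diagonal_apply]
    by_cases h1 : F \ S = E \ S <;> by_cases h2 : F ∩ S = E ∩ S <;> simp [h, h1, h2]

namespace GenericCellulation

section faces

variable {d : ℕ} {X : Type*} [TopologicalSpace X] (C : GenericCellulation d X)

/-! ### Counting cells -/

theorem LocalModel.up_univ {C : GenericCellulation d X} {b : C.Cell} (M : C.LocalModel b) :
    (Finset.univ : Finset (Fin (d + 1 - C.dim b))).Nonempty ∧ M.up Finset.univ = b := by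
  obtain ⟨s, hs, e⟩ := M.exists_up b le_rfl
  have hu : (Finset.univ : Finset (Fin (d + 1 - C.dim b))).Nonempty := hs.mono (Finset.subset_univ _)
  refine ⟨hu, le_antisymm ?_ (M.le_up _ hu)⟩
  exact ((M.up_le_up _ _ hu hs).2 (Finset.subset_univ _)).trans e.le

/-- A proper face of `c` is a facet of a face of `c`. -/
theorem exists_coface {b c : C.Cell} (h : b < c) :
    ∃ b', b < b' ∧ C.dim b' = C.dim b + 1 ∧ b' ≤ c := by
  obtain ⟨M⟩ := C.nonempty_localModel b
  obtain ⟨s, hs, rfl⟩ := M.exists_up c h.le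
  obtain ⟨x, hx⟩ : ∃ x, x ∉ s := by
    by_contra! hall
    have : s = Finset.univ := Finset.eq_univ_of_forall hall
    -- The cell `b` is dual to the full simplex, so `c > b` misses a vertex `x`; the face opposite
    -- `x` is the required cell.
    rw [this, M.up_univ.2] at h
    exact h.false
  have hsub : s ⊆ Finset.univ.erase x := fun y hy =>
    Finset.mem_erase.2 ⟨fun e => hx (e ▸ hy), Finset.mem_univ _⟩
  have hne : (Finset.univ.erase x).Nonempty := hs.mono hsub
  have hdim := M.dim_up _ hne
  have hpos := hne.card_pos
  rw [Finset.card_erase_of_mem (Finset.mem_univ _), Finset.card_univ, Fintype.card_fin] at hdim hpos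
  have hdim' : C.dim (M.up (Finset.univ.erase x)) = C.dim b + 1 := by lia
  refine ⟨_, lt_of_le_of_ne (M.le_up _ hne) fun e => ?_, hdim', (M.up_le_up _ _ hne hs).2 hsub⟩
  rw [← e] at hdim'
  lia

theorem dim_lt_dim {b c : C.Cell} (h : b < c) : C.dim b < C.dim c := by
  obtain ⟨M⟩ := C.nonempty_localModel b
  obtain ⟨s, hs, rfl⟩ := M.exists_up c h.le
  have hlt : s ⊂ Finset.univ := by
    refine Finset.ssubset_univ_iff.2 fun e => ?_
    rw [e, M.up_univ.2] at h
    exact h.false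
  have h1 := Finset.card_lt_card hlt
  rw [Finset.card_univ, Fintype.card_fin] at h1
  have h2 := M.dim_up s hs
  lia

-- By `exists_coface`, each face of codimension `j + 1` is a facet of one of codimension `j`, at the
-- cost of a factor `K`.
open Classical in
theorem card_faces_codim_le {K : ℕ}
    (hK : ∀ c : C.Cell, {b : C.Cell | b < c ∧ C.dim c = C.dim b + 1}.ncard ≤ K) (c : C.Cell) (j : ℕ) :
    (Finset.univ.filter fun b : C.Cell => b ≤ c ∧ C.dim b + j = C.dim c).card ≤ K ^ j := by
  induction j with
  | zero =>
    rw [pow_zero, Finset.card_le_one]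
    have : ∀ b ∈ Finset.univ.filter fun b : C.Cell => b ≤ c ∧ C.dim b + 0 = C.dim c, b = c := by
      intro b hb
      obtain ⟨-, h1, h2⟩ := Finset.mem_filter.1 hb
      by_contra hne
      have := C.dim_lt_dim (lt_of_le_of_ne h1 hne)
      lia
    intro b hb b' hb'
    rw [this b hb, this b' hb']
  | succ j ih =>
    have hsub : (Finset.univ.filter fun b : C.Cell => b ≤ c ∧ C.dim b + (j + 1) = C.dim c) ⊆
        (Finset.univ.filter fun b : C.Cell => b ≤ c ∧ C.dim b + j = C.dim c).biUnion fun b' =>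
          Finset.univ.filter fun b : C.Cell => b < b' ∧ C.dim b' = C.dim b + 1 := by
      intro b hb
      obtain ⟨-, h1, h2⟩ := Finset.mem_filter.1 hb
      have hlt : b < c := lt_of_le_of_ne h1 fun e => by rw [e] at h2; lia
      obtain ⟨b', hbb', hdim, hb'c⟩ := C.exists_coface hlt
      exact Finset.mem_biUnion.2 ⟨b', Finset.mem_filter.2 ⟨Finset.mem_univ _, hb'c, by lia⟩,
        Finset.mem_filter.2 ⟨Finset.mem_univ _, hbb', hdim⟩⟩
    refine (Finset.card_le_card hsub).trans ?_
    refine (Finset.card_biUnion_le_card_mul _ _ K fun b' _ => ?_).trans ?_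
    · have := hK b'
      rw [Set.ncard_eq_toFinset_card'] at this
      convert this using 2
      ext b
      simp
    · rw [pow_succ]
      exact Nat.mul_le_mul_right _ ih

open Classical in
theorem card_faces_le {K : ℕ}
    (hK : ∀ c : C.Cell, {b : C.Cell | b < c ∧ C.dim c = C.dim b + 1}.ncard ≤ K) (c : C.Cell) :
    (Finset.univ.filter fun b : C.Cell => b ≤ c).card ≤ ∑ j ∈ Finset.range (d + 1), K ^ j := by
  have hsub : (Finset.univ.filter fun b : C.Cell => b ≤ c) ⊆ (Finset.range (d + 1)).biUnion fun j =>
      Finset.univ.filter fun b : C.Cell => b ≤ c ∧ C.dim b + j = C.dim c := by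
    intro b hb
    have hbc := (Finset.mem_filter.1 hb).2
    have h1 : C.dim b ≤ C.dim c := by
      rcases hbc.eq_or_lt with rfl | h
      · exact le_rfl
      · exact (C.dim_lt_dim h).le
    have h2 := C.dim_le c
    exact Finset.mem_biUnion.2 ⟨C.dim c - C.dim b, Finset.mem_range.2 (by lia),
      Finset.mem_filter.2 ⟨Finset.mem_univ _, hbc, by lia⟩⟩
  refine (Finset.card_le_card hsub).trans (Finset.card_biUnion_le.trans ?_)
  exact Finset.sum_le_sum fun j _ => C.card_faces_codim_le hK c j

/-- Genericity alone bounds this: cells around `b` correspond to sets of at most `d + 1` vertices.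
-/
theorem card_cobdry_le (b : C.Cell) : (C.cobdry b).card ≤ 2 ^ (d + 1) := by
  classical
  obtain ⟨M⟩ := C.nonempty_localModel b
  have h : (C.cobdry b).image Subtype.val ⊆ Finset.univ.image M.up := by
    intro f hf
    obtain ⟨g, hg, rfl⟩ := Finset.mem_image.1 hf
    obtain ⟨s, -, e⟩ := M.exists_up g.1 (C.mem_cobdry.1 hg)
    exact Finset.mem_image.2 ⟨s, Finset.mem_univ _, e⟩
  rw [← Finset.card_image_of_injective _ Subtype.val_injective]
  refine (Finset.card_le_card h).trans (Finset.card_image_le.trans ?_)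
  rw [Finset.card_univ, Fintype.card_finset, Fintype.card_fin]
  exact Nat.pow_le_pow_right (by norm_num) (Nat.sub_le _ _)

/-- Two cells conflict when they are faces of a common qubit. A cell lies on at most `2^(d+1)`
qubits, each having boundedly many faces; one colour more than this count suffices for the greedy
argument. -/
theorem exists_cell_coloring {K : ℕ}
    (hK : ∀ c : C.Cell, {b : C.Cell | b < c ∧ C.dim c = C.dim b + 1}.ncard ≤ K) :
    ∃ color : C.Cell → Fin (2 ^ (d + 1) * (∑ j ∈ Finset.range (d + 1), K ^ j) + 1),
      ∀ b b', b ≠ b' → color b = color b' → Disjoint (C.cobdry b) (C.cobdry b') := by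
  classical
  obtain ⟨color, h⟩ := exists_coloring (fun b b' => ¬ Disjoint (C.cobdry b) (C.cobdry b'))
    (fun b b' h h' => h h'.symm) (2 ^ (d + 1) * (∑ j ∈ Finset.range (d + 1), K ^ j) + 1) (by
      intro b
      rw [Nat.lt_succ_iff]
      have hsub : (Finset.univ.filter fun b' => ¬ Disjoint (C.cobdry b) (C.cobdry b')) ⊆
          (C.cobdry b).biUnion fun f => Finset.univ.filter fun b' : C.Cell => b' ≤ f.1 := by
        intro b' hb'
        obtain ⟨f, hf, hf'⟩ := Finset.not_disjoint_iff.1 (Finset.mem_filter.1 hb').2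
        exact Finset.mem_biUnion.2 ⟨f, hf,
          Finset.mem_filter.2 ⟨Finset.mem_univ _, C.mem_cobdry.1 hf'⟩⟩
      refine (Finset.card_le_card hsub).trans ?_
      refine (Finset.card_biUnion_le_card_mul _ _ _ fun f _ => C.card_faces_le hK f.1).trans ?_
      exact Nat.mul_le_mul_right _ (C.card_cobdry_le b))
  exact ⟨color, fun b b' hne e => by_contra fun hd => h b b' hne hd e⟩

/-! ### The circuit -/

/-- The gate of a cell `b`: it is the contribution of `b` to the phase `i^χ`. -/
noncomputable def cellGate (b : C.Cell) : Gate C.Qubit :=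
  phaseGate (C.cobdry b) (Complex.I ^ ((-1 : ℤ) ^ C.dim b)) (by
    rw [star_zpow₀, ← mul_zpow]
    simp)

/-- The diagonal entries of the gate of a cell. -/
noncomputable def cellPhase (b : C.Cell) (E : C.Config) : ℂ :=
  if (E ∩ C.cobdry b).Nonempty then Complex.I ^ ((-1 : ℤ) ^ C.dim b) else 1

/-- A cell contributes to `χ(E)` exactly when some present `(d-1)`-cell contains it, a condition on
the support of its gate alone. -/
theorem prod_cellPhase (E : C.Config) : ∏ b, C.cellPhase b E = Complex.I ^ C.chi E := by
  classical
  have h : ∀ s : Finset C.Cell, Complex.I ^ (∑ b ∈ s, (-1 : ℤ) ^ C.dim b) =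
      ∏ b ∈ s, Complex.I ^ ((-1 : ℤ) ^ C.dim b) := by
    intro s
    induction s using Finset.induction_on with
    | empty => simp
    | insert b s hb ih => rw [Finset.sum_insert hb, Finset.prod_insert hb, zpow_add₀ Complex.I_ne_zero, ih]
  rw [chi_eq, h, closureCells, Finset.prod_filter]
  refine Finset.prod_congr rfl fun b _ => ?_
  have e : (E ∩ C.cobdry b).Nonempty ↔ ∃ f ∈ E, b ≤ f.1 := by
    simp only [Finset.Nonempty, Finset.mem_inter, mem_cobdry]
  simp only [cellPhase, e]

/-- The circuit that performs the gates of the cells, ordered by a colouring of the cells. -/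
noncomputable def coloredCircuit {N : ℕ} (color : C.Cell → Fin N) : Circuit C.Qubit :=
  (List.finRange N).map fun i => (Finset.univ.filter fun b => color b = i).toList.map C.cellGate

/-- All gates are diagonal, so the ordered product of matrices is the image of a commutative product
and any colouring gives the same operator. -/
theorem toOp_coloredCircuit {N : ℕ} (color : C.Cell → Fin N) :
    (C.coloredCircuit color).toOp = C.phaseU := by
  have h1 : ∀ i, (((Finset.univ.filter fun b => color b = i).toList.map C.cellGate).map
      Gate.op).prod =
      Matrix.diagonalRingHom C.Config ℂ (∏ b with color b = i, C.cellPhase b) := by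
    intro i
    rw [← Finset.prod_map_toList, map_list_prod, List.map_map, List.map_map]
    rfl
  calc (C.coloredCircuit color).toOp
      = ((List.finRange N).map fun i => Matrix.diagonalRingHom C.Config ℂ
          (∏ b with color b = i, C.cellPhase b)).prod := by
        rw [Circuit.toOp, coloredCircuit, List.map_map]
        exact congrArg List.prod (List.map_congr_left fun i _ => h1 i)
    _ = Matrix.diagonalRingHom C.Config ℂ
          ((List.finRange N).map fun i => ∏ b with color b = i, C.cellPhase b).prod := by
        rw [map_list_prod, List.map_map]
        rfl
    _ = Matrix.diagonalRingHom C.Config ℂ (∏ b, C.cellPhase b) := by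
        rw [← List.ofFn_eq_map, List.prod_ofFn, Finset.prod_fiberwise]
    _ = C.phaseU := by
        refine congrArg Matrix.diagonal (funext fun E => ?_)
        rw [Finset.prod_apply, prod_cellPhase]

end faces

theorem exists_circuit {d : ℕ} {X : Type*} [MetricSpace X] [CompactSpace X]
    (C : GenericCellulation d X) {K : ℕ} {D : ℝ} (hC : C.BoundedGeometry K D) :
    ∃ P : Circuit C.Qubit, P.IsParallel ∧
      P.depth ≤ 2 ^ (d + 1) * (∑ j ∈ Finset.range (d + 1), K ^ j) + 1 ∧
      (∀ L ∈ P, ∀ g ∈ L, g.support.card ≤ 2 ^ (d + 1) ∧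
        Metric.diam (⋃ f ∈ g.support, (f.1.1 : Set X)) ≤ 2 * |D|) ∧
      P.toOp = C.phaseU := by
  obtain ⟨color, hcolor⟩ := C.exists_cell_coloring hC.face_le
  refine ⟨C.coloredCircuit color, ?_, ?_, ?_, C.toOp_coloredCircuit color⟩
  · intro L hL
    obtain ⟨i, -, rfl⟩ := List.mem_map.1 hL
    rw [List.pairwise_map]
    refine (Finset.nodup_toList _).pairwise_of_forall_ne fun b hb b' hb' hne => ?_
    rw [Finset.mem_toList, Finset.mem_filter] at hb hb'
    exact hcolor b b' hne (hb.2.trans hb'.2.symm)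
  · simp [Circuit.depth, coloredCircuit]
  · intro L hL g hg
    obtain ⟨i, -, rfl⟩ := List.mem_map.1 hL
    obtain ⟨b, -, rfl⟩ := List.mem_map.1 hg
    refine ⟨C.card_cobdry_le b, Metric.diam_le_of_forall_dist_le (by positivity) ?_⟩
    obtain ⟨φ, -, -, hφ, -⟩ := C.exists_charMap b
    -- The image of the centre of the ball is a point of `b`, hence common to all cells in the
    -- support. Each of these cells stays within `|D|` of it, whence `2 * |D|`; the absolute value
    -- keeps the bound nonnegative for every real `D`.
    have hz : φ 0 ∈ b.1 := hφ ▸ Set.mem_image_of_mem φ (by simp)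
    have hdist : ∀ x ∈ ⋃ f ∈ (C.cellGate b).support, (f.1.1 : Set X), dist x (φ 0) ≤ |D| := by
      intro x hx
      obtain ⟨f, hf, hx⟩ := Set.mem_iUnion₂.1 hx
      have hbf : b.1 ⊆ f.1.1 := C.mem_cobdry.1 hf
      exact (Metric.dist_le_diam_of_mem (Metric.isBounded_of_compactSpace) hx (hbf hz)).trans
        ((hC.diam_le f.1).trans (le_abs_self D))
    intro x hx y hy
    have h1 := hdist x hx
    have h2 := hdist y hy
    have h3 := dist_triangle_right x y (φ 0)
    linarith

end GenericCellulation
end GDS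

/-! ### The main theorem -/

theorem mainTheorem9 (d : ℕ) (hd : Odd d) :
    (∀ K : ℕ, ∃ depth size : ℕ, ∀ D : ℝ, ∃ range : ℝ,
      ∀ (X : Type u) [MetricSpace X] [CompactSpace X] [ChartedSpace (EuclideanSpace ℝ (Fin d)) X]
        [IsManifold (𝓡 d) ∞ X] (C : GDS.GenericCellulation d X),
        C.BoundedGeometry K D →
        ∃ P : GDS.Circuit C.Qubit,
          P.IsParallel ∧ P.depth ≤ depth ∧
          (∀ L ∈ P, ∀ g ∈ L, g.support.card ≤ size ∧
            Metric.diam (⋃ f ∈ g.support, (f.1.1 : Set X)) ≤ range) ∧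
          P.toOp = C.phaseU) ∧
    (∀ (X : Type u) [TopologicalSpace X] [T2Space X] [CompactSpace X]
      [ChartedSpace (EuclideanSpace ℝ (Fin d)) X] [IsManifold (𝓡 d) ∞ X]
      (C : GDS.GenericCellulation d X),
      C.phaseU ∈ Matrix.unitaryGroup C.Config ℂ ∧
      IsLeast (GDS.energies C.hGDS) 0 ∧
      IsLeast (GDS.energies C.hGTC) 0 ∧
      Submodule.map (Matrix.toLin' C.phaseU) (GDS.groundSpace C.hGDS) = GDS.groundSpace C.hGTC ∧
      IsLeast (GDS.energies C.hPlus) 0 ∧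
      ∀ ψ ∈ GDS.groundSpace C.hPlus,
        C.phaseU.mulVec ψ ∈ GDS.groundSpace C.hPlus ∧
        C.hSquareGDS.mulVec ψ ∈ GDS.groundSpace C.hPlus ∧
        C.hSquareGTC.mulVec ψ ∈ GDS.groundSpace C.hPlus ∧
        (C.phaseU * C.hSquareGDS * C.phaseU⁻¹).mulVec ψ = C.hSquareGTC.mulVec ψ) := by
  constructor
  · intro K
    refine ⟨2 ^ (d + 1) * (∑ j ∈ Finset.range (d + 1), K ^ j) + 1, 2 ^ (d + 1),
      fun D => ⟨2 * |D|, ?_⟩⟩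
    intro X _ _ _ _ C hC
    exact C.exists_circuit hC
  · intro X _ _ _ _ _ C
    refine ⟨C.phaseU_mem_unitaryGroup, C.isLeast_energies_hGDS hd, C.isLeast_energies_hGTC,
      C.map_phaseU_groundSpace hd, C.isLeast_energies_hPlus, fun ψ hψ => ?_⟩
    simp only [GDS.mem_groundSpace_iff C.isLeast_energies_hPlus] at hψ ⊢
    exact ⟨C.hPlus_mulVec_phaseU hψ, C.hPlus_mulVec_hSquareGDS hψ, C.hPlus_mulVec_hSquareGTC hψ,
      C.phaseU_conj_hSquareGDS hd hψ⟩
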